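/- Let $k>3$ be an integer, and let $\mathcal Q$ be the set of positive fractions with numerator at most $2^{k-1}$, that is, $\mathcal Q=\{a/b : a,b\in\mathbb N,\ 1\le a\le 2^{k-1},\ b\ge 1\}$. For $N\in\mathbb N$ and $p\in[0,1]$ let $G(N,p)$ be the random graph on the vertex set $\{1,\dots,N\}$ in which each of the $\binom N2$ possible edges is present independently with probability $p$. (i) If $\alpha = 1-\frac{1}{2^{k-1}+\beta}$ with $\beta\in(0,\infty)\setminus\mathcal Q$, then $G(N,N^{-\alpha})$ obeys the $k$-zero-one law: for every first-order sentence $\varphi$ in the language of graphs (with the relation symbols $\sim$ for adjacency and $=$ for equality) of quantifier depth at most $k$, the probability that $G(N,N^{-\alpha})$ satisfies $\varphi$ tends to $0$ or tends to $1$ as $N\to\infty$. (ii) The set of all such $\alpha$, $\left\{1-\frac{1}{2^{k-1}+\beta} : \beta\in(0,\infty)\setminus\mathcal Q\right\}$, is an open subset (hence a union of open intervals) of the interval $(1-2^{1-k},1)$, and it contains a rational number. -/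

import Mathlib

open Filter Topology

/-- Quantifier depth of a first-order formula: the maximal number of nested quantifiers. Formulas
are built from `⊥`, atoms, `⟹` and `∀'`; the other connectives and `∃'` abbreviate formulas of the
expected depth (see the lemmas below). -/
def FirstOrder.Language.BoundedFormula.quantifierDepth {L : FirstOrder.Language} {α : Type*} :
    {n : ℕ} → L.BoundedFormula α n → ℕ
  | _, .falsum => 0
  | _, .equal _ _ => 0
  | _, .rel _ _ => 0
  | _, .imp f g => max f.quantifierDepth g.quantifierDepth
  | _, .all f => f.quantifierDepth + 1

theorem FirstOrder.Language.BoundedFormula.quantifierDepth_not {L : FirstOrder.Language}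
    {α : Type*} {n : ℕ} (f : L.BoundedFormula α n) :
    f.not.quantifierDepth = f.quantifierDepth := by
  change max f.quantifierDepth 0 = _
  simp

theorem FirstOrder.Language.BoundedFormula.quantifierDepth_ex {L : FirstOrder.Language}
    {α : Type*} {n : ℕ} (f : L.BoundedFormula α (n + 1)) :
    f.ex.quantifierDepth = f.quantifierDepth + 1 := by
  change f.not.all.not.quantifierDepth = _
  rw [quantifierDepth_not]
  change f.not.quantifierDepth + 1 = _
  rw [quantifierDepth_not]

theorem FirstOrder.Language.BoundedFormula.quantifierDepth_inf {L : FirstOrder.Language}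
    {α : Type*} {n : ℕ} (f g : L.BoundedFormula α n) :
    (f ⊓ g).quantifierDepth = max f.quantifierDepth g.quantifierDepth := by
  change max (max f.quantifierDepth (max g.quantifierDepth 0)) 0 = _
  simp

namespace ZeroOneLaw

/-- The graph `G` satisfies the first-order sentence `φ` in the language of graphs. -/
def Satisfies {V : Type*} (G : SimpleGraph V) (φ : FirstOrder.Language.graph.Sentence) : Prop :=
  @FirstOrder.Language.Sentence.Realize FirstOrder.Language.graph V G.structure φ

/-- The random graph `G(N, p(N))` obeys the `k`-zero-one law: for every first-order sentence of
quantifier depth at most `k`, the probability that it holds tends to `0` or to `1`. -/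
def Obeys (k : ℕ) (p : ℕ → unitInterval) : Prop :=
  ∀ φ : FirstOrder.Language.graph.Sentence, φ.quantifierDepth ≤ k →
    Tendsto (fun N : ℕ => SimpleGraph.binomialRandom (Fin N) (p N) {G | Satisfies G φ})
        atTop (𝓝 0) ∨
      Tendsto (fun N : ℕ => SimpleGraph.binomialRandom (Fin N) (p N) {G | Satisfies G φ})
        atTop (𝓝 1)

/-- The edge probability `N ^ (-α)`; by `coe_edgeProb` the projection to `[0, 1]` changes nothing
for `α ≥ 0`. -/
noncomputable def edgeProb (α : ℝ) (N : ℕ) : unitInterval :=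
  Set.projIcc (0 : ℝ) 1 zero_le_one ((N : ℝ) ^ (-α))

theorem coe_edgeProb {α : ℝ} (hα : 0 ≤ α) (N : ℕ) : (edgeProb α N : ℝ) = (N : ℝ) ^ (-α) := by
  have h0 : (0 : ℝ) ≤ (N : ℝ) ^ (-α) := Real.rpow_nonneg (Nat.cast_nonneg N) _
  have h1 : (N : ℝ) ^ (-α) ≤ 1 := by
    rcases Nat.eq_zero_or_pos N with rfl | hN
    · rcases hα.eq_or_lt with rfl | h
      · simp
      · simp [Real.zero_rpow (neg_ne_zero.mpr h.ne')]
    · exact Real.rpow_le_one_of_one_le_of_nonpos (by exact_mod_cast hN) (by linarith)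
  rw [edgeProb, Set.projIcc_of_mem _ ⟨h0, h1⟩]

/-- The set of positive fractions `a / b` with numerator `a ≤ 2 ^ (k - 1)`. -/
def fractions (k : ℕ) : Set ℝ :=
  {x | ∃ a b : ℕ, 0 < a ∧ a ≤ 2 ^ (k - 1) ∧ 0 < b ∧ x = (a : ℝ) / (b : ℝ)}

/-- The set of all `α = 1 - 1 / (2 ^ (k - 1) + β)` with `β ∈ (0, ∞)` not in `fractions k`. -/
def exponents (k : ℕ) : Set ℝ :=
  {α | ∃ β ∈ Set.Ioi (0 : ℝ) \ fractions k, α = 1 - 1 / ((2 : ℝ) ^ (k - 1) + β)}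

end ZeroOneLaw

/-! Put `s = 2^(k-1)` and `D = s + β`, so that `α = (D-1)/D`. A graph with `v` vertices and `e`
edges has about `N^(v - α e)` expected copies, so everything is governed by the sign of its weight
`D v - (D-1) e`. With probability tending to 1 the random graph satisfies `IsGood` for any fixed
choice of the size parameters (`tendsto_not_isGood`). For suitable parameters any two good graphs,
of whatever orders, agree on sentences of depth at most `k` (`IsGood.satisfies_iff`). Hence a
sentence true in some good graph has limit 1, and any other has limit 0.

The agreement is an Ehrenfeucht game. With `r` rounds left, Duplicator keeps the chosen vertices
inside isomorphic sets closed at scale `2^r`. In the first round the chosen vertex is enclosed by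
repeatedly adjoining fewer than `s` vertices that bring more edges than vertices. Each step lowers
the weight by at least `β`, so sparsity stops the process at bounded size. The resulting set can be
copied to the other graph unless some nonempty subset has weight 0. If such a subset has `b` more
edges than vertices, then `β b` is a positive integer, and the excess bound gives `β b ≤ s`; thus
`β` would be an excluded fraction (`IsEarSet.weight_pos`).

In a later round (`Matched.forth`) a new vertex either lies in a small set adding as many edges as
vertices, which can be copied because it is built from pendant vertices and detached 2-regular
pieces (`IsGood.exists_extension`), or it is free of such sets and is answered by another free
vertex (`IsGood.exists_freeOver`). Each round halves the scale of closedness, and `s` is what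
remains necessary after the first move.

For the exponents: the excluded fractions accumulate only at 0 and are all at most `s`. -/

set_option linter.unusedSectionVars false

namespace ZeroOneLaw

/-! ### Edge counts and partial isomorphisms. -/

section EdgeCount

variable {V V' : Type*} [DecidableEq V] [DecidableEq V']

open Classical in
/-- The number of edges of `G` with both endpoints in `S`. -/
noncomputable def numEdges (G : SimpleGraph V) (S : Finset V) : ℕ :=
  (S.sym2.filter (· ∈ G.edgeSet)).card

open Classical in
/-- The number of neighbours of `v` in `S`. -/
noncomputable def degIn (G : SimpleGraph V) (v : V) (S : Finset V) : ℕ :=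
  (S.filter (G.Adj v)).card

theorem numEdges_mono (G : SimpleGraph V) {S T : Finset V} (h : S ⊆ T) :
    numEdges G S ≤ numEdges G T := by
  classical
  exact Finset.card_le_card (Finset.filter_subset_filter _ (Finset.sym2_mono h))

/-- Supermodularity: an edge lying in both sets lies in the intersection, while edges between `S \
T` and `T \ S` count only on the right. -/
theorem numEdges_add_le (G : SimpleGraph V) (S T : Finset V) :
    numEdges G S + numEdges G T ≤ numEdges G (S ∪ T) + numEdges G (S ∩ T) := by
  classical
  unfold numEdges
  rw [← Finset.card_union_add_card_inter]
  refine add_le_add (Finset.card_le_card ?_) (Finset.card_le_card ?_)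
  · exact Finset.union_subset
      (Finset.filter_subset_filter _ (Finset.sym2_mono Finset.subset_union_left))
      (Finset.filter_subset_filter _ (Finset.sym2_mono Finset.subset_union_right))
  · intro e he
    simp only [Finset.mem_inter, Finset.mem_filter, Finset.mem_sym2_iff] at he ⊢
    exact ⟨fun a ha => ⟨he.1.1 a ha, he.2.1 a ha⟩, he.1.2⟩

@[simp]
theorem numEdges_empty (G : SimpleGraph V) : numEdges G ∅ = 0 := by
  simp [numEdges]

theorem numEdges_insert (G : SimpleGraph V) {v : V} {S : Finset V} (hv : v ∉ S) :
    numEdges G (insert v S) = numEdges G S + degIn G v S := by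
  classical
  unfold numEdges degIn
  have hinj : Set.InjOn (fun u => s(v, u)) (S.filter (G.Adj v) : Finset V) := by
    intro a _ b _ hab
    rcases Sym2.eq_iff.1 hab with h | h
    · exact h.2
    · exact h.2.trans h.1
  rw [← Finset.card_image_of_injOn hinj, ← Finset.card_union_of_disjoint]
  · congr 1
    ext e
    induction e using Sym2.ind with
    | _ a b =>
      simp only [Finset.mem_filter, Finset.mk_mem_sym2_iff, Finset.mem_insert,
        SimpleGraph.mem_edgeSet, Finset.mem_union, Finset.mem_image, Sym2.eq_iff]
      constructor
      · rintro ⟨⟨rfl | ha, rfl | hb⟩, h⟩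
        · exact absurd h (G.loopless.irrefl _)
        · exact Or.inr ⟨b, ⟨hb, h⟩, by simp⟩
        · exact Or.inr ⟨a, ⟨ha, h.symm⟩, by simp⟩
        · exact Or.inl ⟨⟨ha, hb⟩, h⟩
      · rintro (⟨⟨ha, hb⟩, h⟩ | ⟨u, ⟨hu, h⟩, (⟨rfl, rfl⟩ | ⟨rfl, rfl⟩)⟩)
        · exact ⟨⟨Or.inr ha, Or.inr hb⟩, h⟩
        · exact ⟨⟨Or.inl rfl, Or.inr hu⟩, h⟩
        · exact ⟨⟨Or.inr hu, Or.inl rfl⟩, h.symm⟩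
  · rw [Finset.disjoint_left]
    intro e he he'
    simp only [Finset.mem_filter, Finset.mem_image, Finset.mem_sym2_iff] at he he'
    obtain ⟨u, -, rfl⟩ := he'
    exact hv (he.1 v (by simp))

theorem numEdges_singleton (G : SimpleGraph V) (v : V) : numEdges G {v} = 0 := by
  have := numEdges_insert G (v := v) (S := ∅) (by simp)
  simpa [degIn] using this

theorem degIn_mono (G : SimpleGraph V) (v : V) {S T : Finset V} (h : S ⊆ T) :
    degIn G v S ≤ degIn G v T := by
  classical
  exact Finset.card_le_card (Finset.filter_subset_filter _ h)

theorem degIn_insert (G : SimpleGraph V) (v : V) {u : V} {S : Finset V} (hu : u ∉ S)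
    [Decidable (G.Adj v u)] :
    degIn G v (insert u S) = degIn G v S + if G.Adj v u then 1 else 0 := by
  classical
  unfold degIn
  rw [Finset.filter_insert]
  split_ifs with h
  · rw [Finset.card_insert_of_notMem (by simp [hu])]
  · simp

theorem degIn_union (G : SimpleGraph V) (v : V) {S T : Finset V} (h : Disjoint S T) :
    degIn G v (S ∪ T) = degIn G v S + degIn G v T := by
  classical
  unfold degIn
  rw [Finset.filter_union, Finset.card_union_of_disjoint (Finset.disjoint_filter_filter h)]

theorem degIn_eq_zero_iff (G : SimpleGraph V) (v : V) (S : Finset V) :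
    degIn G v S = 0 ↔ ∀ u ∈ S, ¬ G.Adj v u := by
  classical
  simp [degIn, Finset.card_eq_zero, Finset.filter_eq_empty_iff]

theorem numEdges_union (G : SimpleGraph V) {A S : Finset V} (h : Disjoint A S) :
    numEdges G (A ∪ S) = numEdges G A + numEdges G S + ∑ v ∈ S, degIn G v A := by
  induction S using Finset.induction_on with
  | empty => simp
  | insert v S hv ih =>
    rw [Finset.disjoint_insert_right] at h
    rw [Finset.union_insert, numEdges_insert G (by simp [h.1, hv]), ih h.2, numEdges_insert G hv,
      Finset.sum_insert hv, degIn_union G v h.2]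
    ring

/-- The handshake identity inside `S`. -/
theorem sum_degIn (G : SimpleGraph V) (S : Finset V) :
    ∑ v ∈ S, degIn G v S = 2 * numEdges G S := by
  classical
  induction S using Finset.induction_on with
  | empty => simp
  | insert v S hv ih =>
    have h1 : ∑ u ∈ S, degIn G u (insert v S) = ∑ u ∈ S, degIn G u S + degIn G v S := by
      rw [Finset.sum_congr rfl fun u _ => degIn_insert G u hv, Finset.sum_add_distrib]
      congr 1
      rw [← Finset.card_filter, degIn]
      simp only [G.adj_comm]
    rw [Finset.sum_insert hv, h1, ih, numEdges_insert G hv, degIn_insert G v hv]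
    simp
    ring

/-- `h` restricts to an isomorphism from the subgraph of `G` induced on `A` to its image. -/
def IsoOn (G : SimpleGraph V) (G' : SimpleGraph V') (h : V → V') (A : Finset V) : Prop :=
  Set.InjOn h A ∧ ∀ a ∈ A, ∀ b ∈ A, (G.Adj a b ↔ G'.Adj (h a) (h b))

variable {G : SimpleGraph V} {G' : SimpleGraph V'} {h : V → V'} {A B : Finset V}

theorem IsoOn.mono (hA : IsoOn G G' h A) (hBA : B ⊆ A) : IsoOn G G' h B :=
  ⟨hA.1.mono (by exact_mod_cast hBA), fun a ha b hb => hA.2 a (hBA ha) b (hBA hb)⟩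

theorem IsoOn.degIn_image (hA : IsoOn G G' h A) {v : V} (hv : v ∈ A) (hBA : B ⊆ A) :
    degIn G' (h v) (B.image h) = degIn G v B := by
  classical
  unfold degIn
  rw [Finset.filter_image, Finset.card_image_of_injOn]
  · congr 1
    ext u
    simp only [Finset.mem_filter, and_congr_right_iff]
    exact fun hu => (hA.2 v hv u (hBA hu)).symm
  · exact hA.1.mono fun u hu => hBA (Finset.mem_filter.1 hu).1

theorem IsoOn.numEdges_image (hA : IsoOn G G' h A) :
    numEdges G' (A.image h) = numEdges G A := by
  induction A using Finset.induction_on with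
  | empty => simp
  | insert v S hv ih =>
    have hnv : h v ∉ S.image h := by
      intro hc
      obtain ⟨u, hu, huv⟩ := Finset.mem_image.1 hc
      have := hA.1 (by simp [hu]) (by simp) huv
      exact hv (this ▸ hu)
    rw [Finset.image_insert, numEdges_insert _ hnv, numEdges_insert _ hv,
      ih (hA.mono (Finset.subset_insert _ _)),
      hA.degIn_image (Finset.mem_insert_self _ _) (Finset.subset_insert _ _)]

theorem IsoOn.insert (hA : IsoOn G G' h A) {v : V} (hv : v ∉ A) {v' : V'}
    (hv' : ∀ a ∈ A, h a ≠ v') (hadj : ∀ a ∈ A, (G.Adj v a ↔ G'.Adj v' (h a))) :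
    IsoOn G G' (Function.update h v v') (insert v A) := by
  have hne : ∀ a ∈ A, Function.update h v v' a = h a := fun a ha =>
    Function.update_of_ne (ne_of_mem_of_not_mem ha hv) _ _
  refine ⟨?_, ?_⟩
  · intro a ha b hb hab
    simp only [Finset.coe_insert, Set.mem_insert_iff, Finset.mem_coe] at ha hb
    rcases ha with rfl | ha <;> rcases hb with rfl | hb
    · rfl
    · rw [hne b hb, Function.update_self] at hab
      exact absurd hab.symm (hv' b hb)
    · rw [hne a ha, Function.update_self] at hab
      exact absurd hab (hv' a ha)
    · rw [hne a ha, hne b hb] at hab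
      exact hA.1 ha hb hab
  · intro a ha b hb
    rw [Finset.mem_insert] at ha hb
    rcases ha with rfl | ha <;> rcases hb with rfl | hb
    · simp
    · rw [hne b hb, Function.update_self]
      exact hadj b hb
    · rw [hne a ha, Function.update_self, G.adj_comm, G'.adj_comm]
      exact hadj a ha
    · rw [hne a ha, hne b hb]
      exact hA.2 a ha b hb

theorem IsoOn.exists_symm [Nonempty V] (hA : IsoOn G G' h A) :
    ∃ h' : V' → V, IsoOn G' G h' (A.image h) ∧ ∀ a ∈ A, h' (h a) = a := by
  have hl : ∀ a ∈ A, Function.invFunOn h (A : Set V) (h a) = a := fun a ha =>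
    hA.1.leftInvOn_invFunOn ha
  refine ⟨Function.invFunOn h (A : Set V), ⟨?_, ?_⟩, hl⟩
  · intro a ha b hb hab
    simp only [Finset.coe_image, Set.mem_image, Finset.mem_coe] at ha hb
    obtain ⟨a, ha, rfl⟩ := ha
    obtain ⟨b, hb, rfl⟩ := hb
    rw [hl a ha, hl b hb] at hab
    rw [hab]
  · intro a ha b hb
    obtain ⟨a, ha', rfl⟩ := Finset.mem_image.1 ha
    obtain ⟨b, hb', rfl⟩ := Finset.mem_image.1 hb
    rw [hl a ha', hl b hb']
    exact (hA.2 a ha' b hb').symm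

end EdgeCount

/-! ### Closed sets and free vertices. -/

section ClosedSets

variable {V : Type*} [DecidableEq V] {G : SimpleGraph V} {A S : Finset V} {L : ℕ}

/-- Adding fewer than `L` vertices to `A` creates at most as many edges as vertices. -/
def ClosedUpTo (G : SimpleGraph V) (L : ℕ) (A : Finset V) : Prop :=
  ∀ S : Finset V, Disjoint A S → S.card < L → numEdges G (A ∪ S) ≤ numEdges G A + S.card

theorem ClosedUpTo.mono {L' : ℕ} (hA : ClosedUpTo G L A) (h : L' ≤ L) : ClosedUpTo G L' A :=
  fun S hS hc => hA S hS (hc.trans_le h)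

/-- `S` already uses up its own allowance of edges over `A`, so a further `T` has only `|T|` edges
left. Since `|S| + |T| < 2L`, the scale is halved. -/
theorem ClosedUpTo.union (hA : ClosedUpTo G (2 * L) A) (hS : Disjoint A S) (hc : S.card ≤ L)
    (he : numEdges G A + S.card ≤ numEdges G (A ∪ S)) : ClosedUpTo G L (A ∪ S) := by
  intro T hT hTc
  rw [Finset.disjoint_union_left] at hT
  have h1 : (S ∪ T).card = S.card + T.card := Finset.card_union_of_disjoint hT.2
  have h2 := hA (S ∪ T) (Finset.disjoint_union_right.2 ⟨hS, hT.1⟩) (by omega)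
  rw [← Finset.union_assoc] at h2
  omega

/-- `y` lies in no set of at most `L` new vertices spanning with `A` as many new edges. -/
def FreeOver (G : SimpleGraph V) (L : ℕ) (A : Finset V) (y : V) : Prop :=
  ∀ S : Finset V, y ∈ S → Disjoint A S → S.card ≤ L → numEdges G (A ∪ S) ≠ numEdges G A + S.card

/-- Closedness tested on `{y}` allows at most one edge, and freeness excludes exactly one. -/
theorem FreeOver.degIn_eq_zero {y : V} (hy : FreeOver G L A y) (hA : ClosedUpTo G (2 * L) A)
    (hL : 1 ≤ L) (hyA : y ∉ A) : degIn G y A = 0 := by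
  have hd : Disjoint A {y} := by simpa using hyA
  have h1 := hy {y} (by simp) hd (by simpa using hL)
  have h2 := hA {y} hd (by simp; omega)
  rw [Finset.union_comm, ← Finset.insert_eq, numEdges_insert G hyA, Finset.card_singleton] at h1 h2
  omega

/-- Adding `y` together with `T` creates at most `|T| + 1` edges; freeness excludes equality, which
saves the one edge needed. -/
theorem FreeOver.closedUpTo {y : V} (hy : FreeOver G L A y) (hA : ClosedUpTo G (2 * L) A)
    (hyA : y ∉ A) : ClosedUpTo G L (insert y A) := by
  intro T hT hTc
  rw [Finset.disjoint_insert_left] at hT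
  have hd : Disjoint A (insert y T) := Finset.disjoint_insert_right.2 ⟨hyA, hT.2⟩
  have hc : (insert y T).card = T.card + 1 := Finset.card_insert_of_notMem hT.1
  have h1 := hy (insert y T) (by simp) hd (by omega)
  have h2 := hA (insert y T) hd (by omega)
  have h3 : insert y A ∪ T = A ∪ insert y T := by
    rw [Finset.insert_union, Finset.union_insert]
  have h4 := numEdges_mono G (Finset.subset_insert y A)
  rw [h3]
  omega

/-- Tightness survives unions: by supermodularity a loss could only come from the overlap, and
closedness lets the overlap carry no more edges than vertices. The size of the union is
unrestricted. -/
theorem ClosedUpTo.add_card_le_biUnion (hA : ClosedUpTo G (2 * L) A) (hL : 1 ≤ L) {ι : Type*}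
    [DecidableEq ι] (Z : Finset ι) (F : ι → Finset V) (hF : ∀ i ∈ Z, Disjoint A (F i))
    (hc : ∀ i ∈ Z, (F i).card ≤ L)
    (he : ∀ i ∈ Z, numEdges G (A ∪ F i) = numEdges G A + (F i).card) :
    numEdges G A + (Z.biUnion F).card ≤ numEdges G (A ∪ Z.biUnion F) := by
  induction Z using Finset.induction_on with
  | empty => simp
  | insert i Z hi ih =>
    have ih' := ih (fun j hj => hF j (Finset.mem_insert_of_mem hj))
      (fun j hj => hc j (Finset.mem_insert_of_mem hj))
      (fun j hj => he j (Finset.mem_insert_of_mem hj))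
    have hF' := hF i (Finset.mem_insert_self _ _)
    have hc' := hc i (Finset.mem_insert_self _ _)
    have he' := he i (Finset.mem_insert_self _ _)
    rw [Finset.biUnion_insert]
    set U := Z.biUnion F
    have h1 := numEdges_add_le G (A ∪ F i) (A ∪ U)
    rw [← Finset.union_inter_distrib_left, ← Finset.union_union_distrib_left] at h1
    have h2 : (F i ∩ U).card ≤ (F i).card := Finset.card_le_card Finset.inter_subset_left
    have h3 := hA (F i ∩ U) (hF'.mono_right Finset.inter_subset_left) (by omega)
    have h4 := Finset.card_union_add_card_inter (F i) U
    omega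

end ClosedSets

/-! ### Good graphs and the extension of partial isomorphisms. -/

section GoodGraphs

/-- The deterministic properties of a random graph which the game strategy relies on. -/
structure IsGood {V : Type} [DecidableEq V] (G : SimpleGraph V) (D : ℝ) (s M m K n₀ : ℕ) :
    Prop where
  sparse : ∃ Y : Finset V, Y.card = m ∧ ∀ W : Finset V, Disjoint Y W → W.card ≤ K →
    (D - 1) * numEdges G (Y ∪ W) ≤ D * W.card
  degree : ∀ (v : V) (A : Finset V), A.card ≤ M → ∃ u ∉ A, G.Adj v u
  copies : ∀ n ≤ n₀, ∀ H : SimpleGraph (Fin n),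
    (∀ I : Finset (Fin n), I.Nonempty → (D - 1) * numEdges H I < D * I.card) →
    ∃ f : Fin n ↪ V, (∀ i j, G.Adj (f i) (f j) ↔ H.Adj i j) ∧
      ClosedUpTo G s (Finset.univ.image f)

variable {V V' : Type} [DecidableEq V] [DecidableEq V'] {G : SimpleGraph V} {G' : SimpleGraph V'}
  {D : ℝ} {s M m K n₀ L : ℕ} {A : Finset V} {h : V → V'}

theorem IsGood.numEdges_le (hG : IsGood G D s M m K n₀) (hD : 1 < D) {W : Finset V}
    (hW : W.card ≤ K) : (D - 1) * numEdges G W ≤ D * W.card := by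
  obtain ⟨Y, -, hY⟩ := hG.sparse
  have hsub : W \ Y ⊆ W := Finset.sdiff_subset
  have h1 := hY (W \ Y) Finset.disjoint_sdiff ((Finset.card_le_card hsub).trans hW)
  have h2 : (numEdges G W : ℝ) ≤ numEdges G (Y ∪ W \ Y) := by
    exact_mod_cast numEdges_mono G (by rw [Finset.union_sdiff_self_eq_union]
                                       exact Finset.subset_union_right)
  have h3 : ((W \ Y).card : ℝ) ≤ W.card := by exact_mod_cast Finset.card_le_card hsub
  nlinarith

theorem IsGood.exists_copy (hG : IsGood G D s M m K n₀) {ι : Type} [Fintype ι] [DecidableEq ι]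
    (hι : Fintype.card ι ≤ n₀) (H : SimpleGraph ι)
    (hH : ∀ I : Finset ι, I.Nonempty → (D - 1) * numEdges H I < D * I.card) :
    ∃ f : ι ↪ V, (∀ i j, G.Adj (f i) (f j) ↔ H.Adj i j) ∧
      ClosedUpTo G s (Finset.univ.image f) := by
  let e := Fintype.equivFin ι
  have hiso : ∀ I, IsoOn (H.comap e.symm) H e.symm I := fun I =>
    ⟨e.symm.injective.injOn, fun a _ b _ => Iff.rfl⟩
  obtain ⟨f, hf, hcl⟩ := hG.copies _ hι (H.comap e.symm) fun I hI => by
    rw [← (hiso I).numEdges_image]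
    have := hH (I.image e.symm) (hI.image _)
    rwa [Finset.card_image_of_injective _ e.symm.injective] at this
  refine ⟨e.toEmbedding.trans f, fun i j => ?_, ?_⟩
  · simpa using hf (e i) (e j)
  · convert hcl using 1
    ext v
    simp only [Finset.mem_image, Finset.mem_univ, true_and, Function.Embedding.trans_apply,
      Equiv.coe_toEmbedding]
    exact ⟨fun ⟨i, hi⟩ => ⟨e i, hi⟩, fun ⟨i, hi⟩ => ⟨e.symm i, by simpa using hi⟩⟩

/-- In a good graph some vertex is free over a given closed set. -/
theorem IsGood.exists_freeOver (hG : IsGood G D s M m K n₀) (hK : M + m * s ≤ K)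
    (hm : D * M < m * (D - s)) (hD : 1 < D) (hL : 1 ≤ L) (hLs : L ≤ s)
    (hA : ClosedUpTo G (2 * L) A) (hAM : A.card ≤ M) : ∃ y ∉ A, FreeOver G L A y := by
  by_contra hcon
  simp only [FreeOver] at hcon
  push Not at hcon
  obtain ⟨Y, hYm, hY⟩ := hG.sparse
  choose! F hyF hF hc he using hcon
  have hmem : ∀ y ∈ Y \ A, y ∉ A := fun y hy => (Finset.mem_sdiff.1 hy).2
  have h1 := hA.add_card_le_biUnion hL (Y \ A) F (fun y hy => hF y (hmem y hy))
    (fun y hy => hc y (hmem y hy)) (fun y hy => he y (hmem y hy))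
  have h2 : ((Y \ A).biUnion F).card ≤ m * s := by
    refine (Finset.card_biUnion_le_card_mul _ _ s fun y hy => (hc y (hmem y hy)).trans hLs).trans ?_
    exact Nat.mul_le_mul_right _ ((Finset.card_le_card Finset.sdiff_subset).trans hYm.le)
  have hdisj : Disjoint A ((Y \ A).biUnion F) :=
    (Finset.disjoint_biUnion_right _ _ _).2 fun y hy => hF y (hmem y hy)
  have hYsub : Y ⊆ A ∪ (Y \ A).biUnion F := by
    intro y hy
    by_cases hyA : y ∈ A
    · exact Finset.mem_union_left _ hyA
    · exact Finset.mem_union_right _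
        (Finset.mem_biUnion.2 ⟨y, Finset.mem_sdiff.2 ⟨hy, hyA⟩, hyF y hyA⟩)
  -- `A ∪ U` contains `Y`, whose `m` vertices contribute nothing to the weight allowance in
  -- `sparse`. As `A ∪ U` has at least `|U|` edges and `|U| ≤ m s`, this yields `m (D - s) ≤ D M`,
  -- against `hm`.
  set U := (Y \ A).biUnion F
  have h3 : ((A ∪ U) \ Y).card + m = A.card + U.card := by
    rw [← hYm, Finset.card_sdiff_add_card_eq_card hYsub, Finset.card_union_of_disjoint hdisj]
  have h4 := hY ((A ∪ U) \ Y) Finset.disjoint_sdiff (by omega)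
  rw [Finset.union_sdiff_of_subset hYsub] at h4
  have h5 : (((A ∪ U) \ Y).card : ℝ) + m = A.card + U.card := by exact_mod_cast h3
  have h6 : (U.card : ℝ) ≤ numEdges G (A ∪ U) := by exact_mod_cast (by omega)
  have h7 : (U.card : ℝ) ≤ m * s := by exact_mod_cast h2
  have h8 : (A.card : ℝ) ≤ M := by exact_mod_cast hAM
  nlinarith

/-- A pendant vertex over `A ∪ S` can be copied into a good graph. -/
theorem IsGood.exists_pendant (hG' : IsGood G' D s M m K n₀) {S : Finset V} {v : V}
    (hAS : Disjoint A S) (hv : v ∉ A ∪ S) (hiso : IsoOn G G' h (A ∪ S))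
    (hA' : ClosedUpTo G' (2 * L) (A.image h)) (hM : A.card + L ≤ M) (hc : S.card < L)
    (he : numEdges G (A ∪ S) = numEdges G A + S.card) (hdeg : degIn G v (A ∪ S) = 1) :
    ∃ v', IsoOn G G' (Function.update h v v') (insert v (A ∪ S)) := by
  classical
  obtain ⟨u, hu⟩ := Finset.card_eq_one.1 hdeg
  have hu' : u ∈ A ∪ S ∧ G.Adj v u := by
    have : u ∈ (A ∪ S).filter (G.Adj v) := by rw [hu]; simp
    simpa [-Finset.mem_union] using this
  have hcard : ((A ∪ S).image h).card ≤ M :=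
    Finset.card_image_le.trans ((Finset.card_union_le _ _).trans (by omega))
  obtain ⟨v', hv', hadj⟩ := hG'.degree (h u) ((A ∪ S).image h) hcard
  have hAiso := hiso.mono (Finset.subset_union_left (s₁ := A) (s₂ := S))
  -- The image of `S` already brings `|S|` new edges, so closedness of the image of `A` leaves at
  -- most one edge for `v'`: the neighbour supplied by `degree` is the only one.
  have hd : degIn G' v' ((A ∪ S).image h) ≤ 1 := by
    have hdisj : Disjoint (A.image h) (insert v' (S.image h)) := by
      rw [Finset.disjoint_left]
      intro w hw hw'
      obtain ⟨a, ha, rfl⟩ := Finset.mem_image.1 hw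
      rcases Finset.mem_insert.1 hw' with hw' | hw'
      · exact hv' (hw' ▸ Finset.mem_image_of_mem _ (Finset.mem_union_left _ ha))
      · obtain ⟨b, hb, hab⟩ := Finset.mem_image.1 hw'
        have := hiso.1 (by simp [hb]) (by simp [ha]) hab
        exact Finset.disjoint_left.1 hAS ha (this ▸ hb)
    have hcS : (insert v' (S.image h)).card ≤ S.card + 1 :=
      (Finset.card_insert_le _ _).trans (by simpa using Finset.card_image_le)
    have h1 := hA' _ hdisj (by omega)
    rw [Finset.union_insert, ← Finset.image_union, numEdges_insert _ hv', hiso.numEdges_image,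
      hAiso.numEdges_image] at h1
    omega
  refine ⟨v', hiso.insert hv (fun a ha hav => hv' (hav ▸ Finset.mem_image_of_mem _ ha)) ?_⟩
  intro a ha
  constructor
  · intro hva
    have : a ∈ (A ∪ S).filter (G.Adj v) := Finset.mem_filter.2 ⟨ha, hva⟩
    rw [hu, Finset.mem_singleton] at this
    rw [this]
    exact hadj.symm
  · intro hva
    have h2 := Finset.card_le_one.1 hd (h a)
      (Finset.mem_filter.2 ⟨Finset.mem_image_of_mem _ ha, hva⟩) (h u)
      (Finset.mem_filter.2 ⟨Finset.mem_image_of_mem _ hu'.1, hadj.symm⟩)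
    rw [hiso.1 ha hu'.1 h2]
    exact hu'.2

/-- The disjoint union of copies, indexed by `κ`, of the subgraph of `G` induced on `S`. -/
def copiesGraph (G : SimpleGraph V) (S : Finset V) (κ : Type) : SimpleGraph (κ × S) where
  Adj p q := p.1 = q.1 ∧ G.Adj p.2 q.2
  symm := ⟨fun _ _ hpq => ⟨hpq.1.symm, hpq.2.symm⟩⟩
  loopless := ⟨fun _ hp => G.loopless.irrefl _ hp.2⟩

/-- All degrees stay at most 2, so the handshake identity applies. This gives every nonempty part
positive weight. -/
theorem numEdges_copiesGraph_le {S : Finset V} {κ : Type} [DecidableEq κ]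
    (hS : ∀ v ∈ S, degIn G v S ≤ 2) (I : Finset (κ × S)) :
    numEdges (copiesGraph G S κ) I ≤ I.card := by
  classical
  have h1 : ∀ p ∈ I, degIn (copiesGraph G S κ) p I ≤ 2 := by
    intro p _
    refine le_trans ?_ (hS p.2 p.2.2)
    refine Finset.card_le_card_of_injOn (fun q => (q.2 : V)) ?_ ?_
    · intro q hq
      exact Finset.mem_filter.2 ⟨q.2.2, (Finset.mem_filter.1 hq).2.2⟩
    · intro q hq q' hq' hqq
      have e1 := (Finset.mem_filter.1 hq).2.1
      have e2 := (Finset.mem_filter.1 hq').2.1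
      exact Prod.ext (e1.symm.trans e2) (Subtype.ext hqq)
  have h2 := sum_degIn (copiesGraph G S κ) I
  have h3 := Finset.sum_le_card_nsmul I _ 2 h1
  rw [smul_eq_mul] at h3
  omega

/-- A two-regular piece detached from `A` can be copied into a good graph. -/
theorem IsGood.exists_detached (hG' : IsGood G' D s M m K n₀) (hn₀ : (M + 1) * s ≤ n₀)
    (hD : 1 < D) (hLs : L ≤ s) {S : Finset V} (hAS : Disjoint A S) (hiso : IsoOn G G' h A)
    (hA' : ClosedUpTo G' (2 * L) (A.image h)) (hM : A.card ≤ M) (hc : S.card ≤ L)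
    (he : numEdges G S = S.card) (hadj : ∀ v ∈ S, degIn G v A = 0)
    (hreg : ∀ v ∈ S, degIn G v S ≤ 2) :
    ∃ h₂ : V → V', (∀ a ∈ A, h₂ a = h a) ∧ IsoOn G G' h₂ (A ∪ S) := by
  classical
  rcases S.eq_empty_or_nonempty with rfl | hne
  · exact ⟨h, fun _ _ => rfl, by simpa using hiso⟩
  have hpos := hne.card_pos
  obtain ⟨f, hf, -⟩ := hG'.exists_copy (ι := Fin (M + 1) × S)
    (by
      rw [Fintype.card_prod, Fintype.card_fin, Fintype.card_coe]
      exact (Nat.mul_le_mul_left _ (hc.trans hLs)).trans hn₀)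
    (copiesGraph G S (Fin (M + 1))) (fun I hI => by
      have h1 : (numEdges (copiesGraph G S (Fin (M + 1))) I : ℝ) ≤ I.card := by
        exact_mod_cast numEdges_copiesGraph_le hreg I
      have h2 : (0 : ℝ) < I.card := by exact_mod_cast hI.card_pos
      nlinarith)
  -- Pigeonhole: the `M + 1` copies are disjoint and the image of `A` has at most `M` points.
  obtain ⟨i, hi⟩ : ∃ i, ∀ v, f (i, v) ∉ A.image h := by
    by_contra hcon
    push Not at hcon
    choose w hw using hcon
    have h1 := Finset.card_le_card_of_injOn (s := Finset.univ) (t := A.image h)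
      (fun i => f (i, w i)) (fun i _ => hw i)
      (fun i _ j _ hij => congrArg Prod.fst (f.injective hij))
    have h2 := Finset.card_image_le (s := A) (f := h)
    simp only [Finset.card_univ, Fintype.card_fin] at h1
    omega
  let h₂ : V → V' := fun x => if hx : x ∈ S then f (i, ⟨x, hx⟩) else h x
  have h₂A : ∀ a ∈ A, h₂ a = h a := fun a ha => dif_neg (Finset.disjoint_left.1 hAS ha)
  have h₂S : ∀ x (hx : x ∈ S), h₂ x = f (i, ⟨x, hx⟩) := fun x hx => dif_pos hx
  have hisoS : IsoOn G G' h₂ S := by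
    refine ⟨fun a ha b hb hab => ?_, fun a ha b hb => ?_⟩
    · rw [h₂S a ha, h₂S b hb] at hab
      simpa using f.injective hab
    · rw [h₂S a ha, h₂S b hb, hf]
      simp [copiesGraph]
  have hnot : ∀ a ∈ A, ∀ b ∈ S, h a ≠ h₂ b := by
    intro a ha b hb hab
    refine hi ⟨b, hb⟩ ?_
    rw [← h₂S b hb, ← hab]
    exact Finset.mem_image_of_mem _ ha
  have hdisj : Disjoint (A.image h) (S.image h₂) := by
    rw [Finset.disjoint_left]
    intro w hw hw'
    obtain ⟨a, ha, rfl⟩ := Finset.mem_image.1 hw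
    obtain ⟨b, hb, hab⟩ := Finset.mem_image.1 hw'
    exact hnot a ha b hb hab.symm
  have hcS : (S.image h₂).card = S.card := Finset.card_image_of_injOn hisoS.1
  -- The copy of `S` has `|S|` internal edges, exhausting the allowance of the closed set; hence no
  -- edge joins it to the image of `A`.
  have h1 := hA' _ hdisj (by omega)
  rw [numEdges_union _ hdisj, hisoS.numEdges_image, hcS] at h1
  have h2 : ∑ v ∈ S.image h₂, degIn G' v (A.image h) = 0 := by omega
  have hadj' : ∀ a ∈ A, ∀ b ∈ S, ¬ G'.Adj (h₂ b) (h a) := fun a ha b hb =>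
    (degIn_eq_zero_iff _ _ _).1
      (Finset.sum_eq_zero_iff.1 h2 _ (Finset.mem_image_of_mem _ hb)) _
      (Finset.mem_image_of_mem _ ha)
  have hadj₀ : ∀ a ∈ A, ∀ b ∈ S, ¬ G.Adj b a := fun a ha b hb =>
    (degIn_eq_zero_iff _ _ _).1 (hadj b hb) a ha
  refine ⟨h₂, h₂A, fun a ha b hb hab => ?_, fun a ha b hb => ?_⟩
  · rcases Finset.mem_union.1 ha with ha | ha <;> rcases Finset.mem_union.1 hb with hb | hb
    · rw [h₂A a ha, h₂A b hb] at hab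
      exact hiso.1 ha hb hab
    · rw [h₂A a ha] at hab
      exact absurd hab (hnot a ha b hb)
    · rw [h₂A b hb] at hab
      exact absurd hab.symm (hnot b hb a ha)
    · exact hisoS.1 ha hb hab
  · rcases Finset.mem_union.1 ha with ha | ha <;> rcases Finset.mem_union.1 hb with hb | hb
    · rw [h₂A a ha, h₂A b hb]
      exact hiso.2 a ha b hb
    · rw [h₂A a ha, G.adj_comm, G'.adj_comm]
      exact iff_of_false (hadj₀ a ha b hb) (hadj' a ha b hb)
    · rw [h₂A b hb]
      exact iff_of_false (hadj₀ b hb a ha) (hadj' b hb a ha)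
    · exact hisoS.2 a ha b hb

/-- A vertex of `S` with at most one neighbour in the rest has exactly one, since closedness bounds
the edges of the remainder; it is peeled off, and the remainder is again tight. When no such vertex
exists, a degree count shows that `S` is 2-regular and detached from `A`. -/
theorem IsGood.exists_extension (hG' : IsGood G' D s M m K n₀) (hn₀ : (M + 1) * s ≤ n₀)
    (hD : 1 < D) (hLs : L ≤ s) (hiso : IsoOn G G' h A) (hA : ClosedUpTo G (2 * L) A)
    (hA' : ClosedUpTo G' (2 * L) (A.image h)) (hM : A.card + L ≤ M) (n : ℕ) :
    ∀ S : Finset V, S.card = n → Disjoint A S → S.card ≤ L →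
      numEdges G (A ∪ S) = numEdges G A + S.card →
      ∃ h₂ : V → V', (∀ a ∈ A, h₂ a = h a) ∧ IsoOn G G' h₂ (A ∪ S) := by
  induction n with
  | zero =>
    intro S hS _ _ _
    rw [Finset.card_eq_zero.1 hS, Finset.union_empty]
    exact ⟨h, fun _ _ => rfl, hiso⟩
  | succ n ih =>
    intro S hSn hAS hc he
    by_cases hex : ∃ v ∈ S, degIn G v (A ∪ S.erase v) ≤ 1
    · obtain ⟨v, hv, hdeg⟩ := hex
      have hvA : v ∉ A := Finset.disjoint_right.1 hAS hv
      have hAS' : Disjoint A (S.erase v) := hAS.mono_right (Finset.erase_subset _ _)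
      have hcard : (S.erase v).card + 1 = S.card := Finset.card_erase_add_one hv
      have hvB : v ∉ A ∪ S.erase v := by simp [hvA]
      have hins : insert v (A ∪ S.erase v) = A ∪ S := by
        rw [← Finset.union_insert, Finset.insert_erase hv]
      have h1 := numEdges_insert G hvB
      rw [hins] at h1
      have h2 := hA _ hAS' (by omega)
      obtain ⟨h₁, hag, hiso₁⟩ := ih (S.erase v) (by omega) hAS' (by omega) (by omega)
      have himg : A.image h₁ = A.image h := Finset.image_congr fun a ha => hag a ha
      obtain ⟨v', hv'⟩ := hG'.exists_pendant (L := L) hAS' hvB hiso₁ (by rwa [himg]) hM (by omega)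
        (by omega) (by omega)
      rw [hins] at hv'
      refine ⟨_, fun a ha => ?_, hv'⟩
      rw [Function.update_of_ne (ne_of_mem_of_not_mem ha hvA)]
      exact hag a ha
    · push Not at hex
      have hdeg : ∀ v ∈ S, 2 ≤ degIn G v A + degIn G v S := by
        intro v hv
        rw [← degIn_union G v hAS]
        refine le_trans (hex v hv) (degIn_mono G v ?_)
        exact Finset.union_subset_union_right (Finset.erase_subset _ _)
      -- With `c` edges between `A` and `S` and `e` inside `S`, the degrees give `c + 2e ≥ 2|S|`
      -- while tightness gives `c + e = |S|`; so `c = 0`.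
      have h1 := Finset.card_nsmul_le_sum S _ 2 hdeg
      rw [Finset.sum_add_distrib, sum_degIn, smul_eq_mul] at h1
      have h2 := numEdges_union G hAS
      have h3 : ∑ v ∈ S, degIn G v A = 0 := by omega
      have hzero := Finset.sum_eq_zero_iff.1 h3
      refine hG'.exists_detached hn₀ hD hLs hAS hiso hA' (by omega) hc (by omega) hzero ?_
      have h4 : ∑ v ∈ S, degIn G v S = ∑ v ∈ S, 2 := by
        rw [sum_degIn, Finset.sum_const, smul_eq_mul]
        omega
      have h5 := (Finset.sum_eq_sum_iff_of_le fun v hv => by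
        have := hdeg v hv
        rw [hzero v hv] at this
        omega).1 h4.symm
      exact fun v hv => (h5 v hv).ge

end GoodGraphs

/-! ### Enclosing the first vertex in a bounded closed set. -/

section ClosureOfVertex

variable {V : Type} [DecidableEq V] {G : SimpleGraph V} {D : ℝ} {s M₀ K : ℕ}

/-- A set containing `x` whose number of edges is at most `s` times one plus its excess of edges
over vertices, and whose excess is maximal among its nonempty subsets. -/
def IsEarSet (G : SimpleGraph V) (s : ℕ) (x : V) (T : Finset V) : Prop :=
  x ∈ T ∧ (numEdges G T : ℤ) ≤ s * (numEdges G T - T.card + 1) ∧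
    ∀ I ⊆ T, I.Nonempty → (numEdges G I : ℤ) - I.card ≤ numEdges G T - T.card

theorem isEarSet_singleton (G : SimpleGraph V) (s : ℕ) (x : V) : IsEarSet G s x {x} := by
  refine ⟨by simp, by simp [numEdges_singleton], fun I hI hne => ?_⟩
  rw [(Finset.subset_singleton_iff.1 hI).resolve_left hne.ne_empty]

/-- Write `x` for the excess. Nonnegative weight says `D x ≤ e`, and the ear condition says `e ≤ s
(x + 1)`. -/
theorem IsEarSet.excess_le {x : V} {T : Finset V} (hT : IsEarSet G s x T)
    (hw : (D - 1) * numEdges G T ≤ D * T.card) :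
    (D - s) * ((numEdges G T : ℝ) - T.card) ≤ s := by
  have h1 : (numEdges G T : ℝ) ≤ s * (numEdges G T - T.card + 1) := by exact_mod_cast hT.2.1
  nlinarith

theorem IsEarSet.card_le {x : V} {T : Finset V} (hs : 1 ≤ s) (hsD : (s : ℝ) < D)
    (hM₀ : ((s : ℝ) - 1) * (s / (D - s)) + s ≤ M₀) (hT : IsEarSet G s x T)
    (hw : (D - 1) * numEdges G T ≤ D * T.card) : T.card ≤ M₀ := by
  have h1 : (numEdges G T : ℝ) ≤ s * (numEdges G T - T.card + 1) := by exact_mod_cast hT.2.1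
  have h2 := hT.excess_le hw
  have h3 : (numEdges G T : ℝ) - T.card ≤ s / (D - s) := by
    rw [le_div_iff₀ (by linarith)]
    linarith
  have hs' : (1 : ℝ) ≤ s := by exact_mod_cast hs
  have h4 : (T.card : ℝ) ≤ M₀ := by nlinarith
  exact_mod_cast h4

/-- Adjoin a smallest set `W` violating closedness. Minimality bounds the edges brought by proper
parts of `W`, which is what keeps the excess maximal at the whole set. -/
theorem IsEarSet.exists_larger {x : V} {T : Finset V} (hs : 1 ≤ s) (hsD : (s : ℝ) < D)
    (hsp : ∀ W : Finset V, W.card ≤ K → (D - 1) * numEdges G W ≤ D * W.card) (hsK : s ≤ K)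
    (hT : IsEarSet G s x T) (hcl : ¬ ClosedUpTo G s T) :
    ∃ T', IsEarSet G s x T' ∧ T.card < T'.card ∧ T'.card < T.card + s := by
  classical
  have hex : ∃ n, ∃ W : Finset V, W.card = n ∧ Disjoint T W ∧ W.card < s ∧
      numEdges G T + W.card < numEdges G (T ∪ W) := by
    unfold ClosedUpTo at hcl
    push Not at hcl
    obtain ⟨W, h1, h2, h3⟩ := hcl
    exact ⟨_, W, rfl, h1, h2, h3⟩
  obtain ⟨W, hWn, hTW, hWs, hWe⟩ := Nat.find_spec hex
  have hmin : ∀ I ⊆ W, I ≠ W → numEdges G (T ∪ I) ≤ numEdges G T + I.card := by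
    intro I hI hne
    by_contra hcon
    have hlt : I.card < W.card := Finset.card_lt_card (hI.ssubset_of_ne hne)
    exact Nat.find_min hex (hWn ▸ hlt)
      ⟨I, rfl, hTW.mono_right hI, hlt.trans hWs, not_le.1 hcon⟩
  have hcard : (T ∪ W).card = T.card + W.card := Finset.card_union_of_disjoint hTW
  have hWpos : 0 < W.card := by
    rcases W.eq_empty_or_nonempty with rfl | h
    · simp at hWe
    · exact h.card_pos
  have hx := hT.2.2 {x} (by simpa using hT.1) (by simp)
  rw [numEdges_singleton, Finset.card_singleton] at hx
  refine ⟨T ∪ W, ⟨Finset.mem_union_left _ hT.1, ?_, ?_⟩, by omega, by omega⟩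
  -- If the excess grows by `c ≥ 1`, the edge count grows by `|W| + c ≤ s - 1 + c ≤ s c`.
  · have h1 := hT.2.1
    rw [hcard]
    push_cast at hx ⊢
    have h2 : (numEdges G T : ℤ) + W.card + 1 ≤ numEdges G (T ∪ W) := by exact_mod_cast hWe
    have h3 : (W.card : ℤ) + 1 ≤ s := by exact_mod_cast hWs
    nlinarith
  · intro I hI hne
    have hIW : I \ T ⊆ W := by
      intro v hv
      rw [Finset.mem_sdiff] at hv
      exact (Finset.mem_union.1 (hI hv.1)).resolve_left hv.2
    -- A set missing `T` has fewer than `s < D` vertices, so sparsity makes its excess at most 0.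
    -- The new total is at least 0: `{x}` shows that `T` has excess at least `-1`, and `W` adds at
    -- least 1. A set meeting `T` is treated by supermodularity.
    rcases (I ∩ T).eq_empty_or_nonempty with hemp | hne'
    · have hsub : I ⊆ W := by
        intro v hv
        refine (Finset.mem_union.1 (hI hv)).resolve_left fun hvT => ?_
        exact Finset.notMem_empty v (hemp ▸ Finset.mem_inter.2 ⟨hv, hvT⟩)
      have h1 : I.card ≤ W.card := Finset.card_le_card hsub
      have h2 := hsp I (by omega)
      have h3 : numEdges G I ≤ I.card := by
        by_contra hcon
        have h4 : (I.card : ℝ) + 1 ≤ numEdges G I := by exact_mod_cast not_le.1 hcon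
        have h5 : (I.card : ℝ) + 1 ≤ s := by exact_mod_cast (by omega)
        have h6 : (0 : ℝ) ≤ I.card := Nat.cast_nonneg _
        nlinarith
      push_cast [hcard]
      have h2 : (numEdges G T : ℤ) + W.card + 1 ≤ numEdges G (T ∪ W) := by exact_mod_cast hWe
      omega
    · have h1 := numEdges_add_le G I T
      have h2 := hT.2.2 (I ∩ T) Finset.inter_subset_right hne'
      have h3 : I ∪ T = T ∪ I \ T := by rw [Finset.union_sdiff_self_eq_union, Finset.union_comm]
      have h4 : (I ∩ T).card + (I \ T).card = I.card := Finset.card_inter_add_card_sdiff I T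
      rw [h3] at h1
      by_cases hIe : I \ T = W
      · rw [hIe] at h1 h4
        push_cast [hcard]
        omega
      · have h5 := hmin _ hIW hIe
        push_cast [hcard]
        omega

/-- Enlarge while not closed: the size strictly increases and stays at most `M₀`. The slack `s` in
`K` lets sparsity be applied to the enlarged set before its size is known to be bounded by `M₀`. -/
theorem exists_closed_isEarSet (hs : 1 ≤ s) (hsD : (s : ℝ) < D)
    (hM₀ : ((s : ℝ) - 1) * (s / (D - s)) + s ≤ M₀) (hK : M₀ + s ≤ K)
    (hsp : ∀ W : Finset V, W.card ≤ K → (D - 1) * numEdges G W ≤ D * W.card) (x : V) :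
    ∃ T, IsEarSet G s x T ∧ T.card ≤ M₀ ∧ ClosedUpTo G s T := by
  have key : ∀ j, ∀ T, IsEarSet G s x T → T.card ≤ M₀ → M₀ - T.card ≤ j →
      ∃ T, IsEarSet G s x T ∧ T.card ≤ M₀ ∧ ClosedUpTo G s T := by
    intro j
    induction j with
    | zero =>
      intro T hT hTc hj
      by_cases hcl : ClosedUpTo G s T
      · exact ⟨T, hT, hTc, hcl⟩
      · obtain ⟨T', hT', hlt, hlt'⟩ := hT.exists_larger hs hsD hsp (by omega) hcl
        have := hT'.card_le hs hsD hM₀ (hsp T' (by omega))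
        omega
    | succ j ih =>
      intro T hT hTc hj
      by_cases hcl : ClosedUpTo G s T
      · exact ⟨T, hT, hTc, hcl⟩
      · obtain ⟨T', hT', hlt, hlt'⟩ := hT.exists_larger hs hsD hsp (by omega) hcl
        exact ih T' hT' (hT'.card_le hs hsD hM₀ (hsp T' (by omega))) (by omega)
  exact key _ {x} (isEarSet_singleton G s x) ((isEarSet_singleton G s x).card_le hs hsD hM₀ (by
    rw [numEdges_singleton]
    have : (1 : ℝ) ≤ s := by exact_mod_cast hs
    simp
    linarith)) le_rfl

/-- No subset of an ear set has vanishing weight, since its excess is too small. -/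
theorem IsEarSet.weight_pos {k : ℕ} {β : ℝ} (hβ : β ∈ Set.Ioi (0 : ℝ) \ fractions k)
    (hs : s = 2 ^ (k - 1)) (hD : D = s + β) (hK : M₀ ≤ K)
    (hsp : ∀ W : Finset V, W.card ≤ K → (D - 1) * numEdges G W ≤ D * W.card) {x : V}
    {T : Finset V} (hT : IsEarSet G s x T) (hTc : T.card ≤ M₀) {I : Finset V} (hI : I ⊆ T)
    (hne : I.Nonempty) : (D - 1) * numEdges G I < D * I.card := by
  have hs1 : (1 : ℝ) ≤ s := by
    rw [hs]
    exact_mod_cast Nat.one_le_two_pow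
  have hβ0 : 0 < β := hβ.1
  refine lt_of_le_of_ne (hsp I ((Finset.card_le_card hI).trans (hTc.trans hK))) fun heq => hβ.2 ?_
  have hIpos : (0 : ℝ) < I.card := by exact_mod_cast hne.card_pos
  have hle : numEdges G I - (I.card : ℝ) ≤ numEdges G T - (T.card : ℝ) := by
    exact_mod_cast hT.2.2 I hI hne
  have hex := hT.excess_le (hsp T (hTc.trans hK))
  have hc0 : I.card < numEdges G I := by
    by_contra hcon
    have h1 : (numEdges G I : ℝ) ≤ I.card := by exact_mod_cast not_lt.1 hcon
    nlinarith
  obtain ⟨c, hc⟩ := Nat.exists_eq_add_of_lt hc0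
  have hcR : (numEdges G I : ℝ) = I.card + (c + 1) := by
    rw [hc]
    push_cast
    ring
  have e1 : β * (c + 1) = I.card - ((s : ℝ) - 1) * (c + 1) := by
    rw [hcR, hD] at heq
    linarith
  have e2 : β * ((c : ℝ) + 1) ≤ s := by
    have h1 : (c : ℝ) + 1 ≤ numEdges G T - (T.card : ℝ) := by linarith
    rw [hD] at hex
    nlinarith
  have hsub : (s - 1) * (c + 1) < I.card := by
    have h1 : ((s : ℝ) - 1) * (c + 1) < I.card := by
      linarith [mul_pos hβ0 (by positivity : (0 : ℝ) < c + 1)]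
    have h2 : (((s - 1 : ℕ) : ℝ)) = s - 1 := by
      rw [Nat.cast_sub (by exact_mod_cast hs1)]
      simp
    rw [← h2] at h1
    exact_mod_cast h1
  have hcast : ((I.card - (s - 1) * (c + 1) : ℕ) : ℝ) = β * (c + 1) := by
    rw [Nat.cast_sub hsub.le, e1]
    push_cast [Nat.cast_sub (show 1 ≤ s by exact_mod_cast hs1)]
    ring
  refine ⟨I.card - (s - 1) * (c + 1), c + 1, by omega, ?_, by omega, ?_⟩
  · rw [← hs]
    have : ((I.card - (s - 1) * (c + 1) : ℕ) : ℝ) ≤ s := by rw [hcast]; exact e2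
    exact_mod_cast this
  · rw [hcast]
    push_cast
    field_simp

end ClosureOfVertex

/-! ### The Ehrenfeucht game and Duplicator's strategy. -/

section Game

variable {V V' : Type}

/-- The two tuples satisfy the same atomic formulas. -/
def SameAtoms (G : SimpleGraph V) (G' : SimpleGraph V') {n : ℕ} (v : Fin n → V)
    (v' : Fin n → V') : Prop :=
  ∀ i j, (v i = v j ↔ v' i = v' j) ∧ (G.Adj (v i) (v j) ↔ G'.Adj (v' i) (v' j))

/-- Duplicator wins the game with `r` further rounds from the given position. -/
def DuplicatorWins (G : SimpleGraph V) (G' : SimpleGraph V') :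
    ℕ → {n : ℕ} → (Fin n → V) → (Fin n → V') → Prop
  | 0, _, v, v' => SameAtoms G G' v v'
  | r + 1, _, v, v' => SameAtoms G G' v v' ∧
      (∀ a, ∃ b, DuplicatorWins G G' r (Fin.snoc v a : Fin (_ + 1) → V) (Fin.snoc v' b)) ∧
      ∀ b, ∃ a, DuplicatorWins G G' r (Fin.snoc v a : Fin (_ + 1) → V) (Fin.snoc v' b)

theorem DuplicatorWins.sameAtoms {G : SimpleGraph V} {G' : SimpleGraph V'} {r n : ℕ}
    {v : Fin n → V} {v' : Fin n → V'} (h : DuplicatorWins G G' r v v') : SameAtoms G G' v v' := by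
  cases r with
  | zero => exact h
  | succ r => exact h.1

open FirstOrder Language in
theorem DuplicatorWins.realize_iff {G : SimpleGraph V} {G' : SimpleGraph V'} {n : ℕ}
    (φ : FirstOrder.Language.graph.BoundedFormula Empty n) :
    ∀ {r : ℕ} {v : Fin n → V} {v' : Fin n → V'}, φ.quantifierDepth ≤ r →
      DuplicatorWins G G' r v v' →
      ((letI := G.structure; φ.Realize (Empty.elim : Empty → V) v) ↔
        (letI := G'.structure; φ.Realize (Empty.elim : Empty → V') v')) := by
  let := G.structure
  let := G'.structure
  have hterm : ∀ {n : ℕ} (t : FirstOrder.Language.graph.Term (Empty ⊕ Fin n)), ∃ i : Fin n,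
      ∀ (v : Fin n → V) (v' : Fin n → V'),
        t.realize (Sum.elim (Empty.elim : Empty → V) v) = v i ∧
        t.realize (Sum.elim (Empty.elim : Empty → V') v') = v' i := by
    intro n t
    cases t with
    | var x =>
      rcases x with x | i
      · exact x.elim
      · exact ⟨i, fun v v' => ⟨rfl, rfl⟩⟩
    | func f _ => exact isEmptyElim f
  induction φ with
  | falsum => intros; exact Iff.rfl
  | equal t₁ t₂ =>
    intro r v v' _ hw
    obtain ⟨i, hi⟩ := hterm t₁
    obtain ⟨j, hj⟩ := hterm t₂
    change (t₁.realize _ = t₂.realize _) ↔ (t₁.realize _ = t₂.realize _)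
    rw [(hi v v').1, (hi v v').2, (hj v v').1, (hj v v').2]
    exact (hw.sameAtoms i j).1
  | rel R ts =>
    intro r v v' _ hw
    cases R
    obtain ⟨i, hi⟩ := hterm (ts 0)
    obtain ⟨j, hj⟩ := hterm (ts 1)
    change G.Adj ((ts 0).realize _) ((ts 1).realize _) ↔
      G'.Adj ((ts 0).realize _) ((ts 1).realize _)
    rw [(hi v v').1, (hi v v').2, (hj v v').1, (hj v v').2]
    exact (hw.sameAtoms i j).2
  | imp f g ihf ihg =>
    intro r v v' hd hw
    have hd' : max f.quantifierDepth g.quantifierDepth ≤ r := hd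
    rw [max_le_iff] at hd'
    exact imp_congr (ihf hd'.1 hw) (ihg hd'.2 hw)
  | all f ih =>
    intro r v v' hd hw
    have hd' : f.quantifierDepth + 1 ≤ r := hd
    obtain ⟨r, rfl⟩ : ∃ r', r = r' + 1 := ⟨r - 1, by omega⟩
    have hd'' : f.quantifierDepth ≤ r := by omega
    constructor
    · intro h b
      obtain ⟨a, ha⟩ := hw.2.2 b
      exact (ih hd'' ha).1 (h a)
    · intro h a
      obtain ⟨b, hb⟩ := hw.2.1 a
      exact (ih hd'' hb).2 (h b)

theorem DuplicatorWins.satisfies_iff {G : SimpleGraph V} {G' : SimpleGraph V'} {r : ℕ}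
    (h : DuplicatorWins G G' r (Fin.elim0 : Fin 0 → V) (Fin.elim0 : Fin 0 → V'))
    (φ : FirstOrder.Language.graph.Sentence) (hφ : φ.quantifierDepth ≤ r) :
    Satisfies G φ ↔ Satisfies G' φ := by
  have := h.realize_iff φ hφ
  unfold Satisfies FirstOrder.Language.Sentence.Realize FirstOrder.Language.Formula.Realize
  convert this using 2

variable [DecidableEq V] [DecidableEq V'] {G : SimpleGraph V} {G' : SimpleGraph V'}
  {D : ℝ} {s M m K n₀ : ℕ}

/-- The invariant of the strategy: the chosen vertices lie in closed sets matched by an isomorphism. -/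
def Matched (G : SimpleGraph V) (G' : SimpleGraph V') (M r : ℕ) {n : ℕ} (v : Fin n → V)
    (v' : Fin n → V') : Prop :=
  ∃ (A : Finset V) (h : V → V'), IsoOn G G' h A ∧ ClosedUpTo G (2 ^ r) A ∧
    ClosedUpTo G' (2 ^ r) (A.image h) ∧ A.card + 2 ^ r ≤ M ∧ ∀ i, v i ∈ A ∧ h (v i) = v' i

theorem Matched.sameAtoms {r n : ℕ} {v : Fin n → V} {v' : Fin n → V'}
    (h : Matched G G' M r v v') : SameAtoms G G' v v' := by
  obtain ⟨A, h, hiso, -, -, -, hv⟩ := h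
  intro i j
  rw [← (hv i).2, ← (hv j).2]
  exact ⟨(hiso.1.eq_iff (hv i).1 (hv j).1).symm, hiso.2 _ (hv i).1 _ (hv j).1⟩

theorem Matched.symm {r n : ℕ} {v : Fin (n + 1) → V} {v' : Fin (n + 1) → V'}
    (h : Matched G G' M r v v') : Matched G' G M r v' v := by
  obtain ⟨A, h, hiso, hcl, hcl', hM, hv⟩ := h
  -- The inverse map needs a default value, which is why the position must be nonempty.
  have : Nonempty V := ⟨v 0⟩
  obtain ⟨h', hiso', hinv⟩ := hiso.exists_symm
  have himg : (A.image h).image h' = A := by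
    rw [Finset.image_image]
    ext a
    simp only [Finset.mem_image, Function.comp]
    exact ⟨fun ⟨b, hb, hba⟩ => by rw [← hba, hinv b hb]; exact hb, fun ha => ⟨a, ha, hinv a ha⟩⟩
  refine ⟨A.image h, h', hiso', hcl', by rwa [himg], ?_, fun i => ?_⟩
  · have := Finset.card_image_le (s := A) (f := h)
    omega
  · rw [← (hv i).2]
    exact ⟨Finset.mem_image_of_mem _ (hv i).1, hinv _ (hv i).1⟩

/-- Three cases: `y` is already in `A`, `y` is free over `A`, or a tight set `S` of at most `2^r`
vertices contains it. In each case the closed sets grow by at most `2^r` vertices, matching the fall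
of the reserve from `2^(r+1)` to `2^r`. -/
theorem Matched.forth (hG' : IsGood G' D s M m K n₀) (hn₀ : (M + 1) * s ≤ n₀)
    (hK : M + m * s ≤ K) (hm : D * M < m * (D - s)) (hD : 1 < D) {r n : ℕ} (hr : 2 ^ r ≤ s)
    {v : Fin n → V} {v' : Fin n → V'} (h : Matched G G' M (r + 1) v v') (y : V) :
    ∃ y', Matched G G' M r (Fin.snoc v y : Fin (n + 1) → V) (Fin.snoc v' y') := by
  obtain ⟨A, h, hiso, hcl, hcl', hM, hv⟩ := h
  have hpow : 2 ^ (r + 1) = 2 * 2 ^ r := by ring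
  have hpos : 1 ≤ 2 ^ r := Nat.one_le_two_pow
  rw [hpow] at hcl hcl' hM
  have finish : ∀ (B : Finset V) (h₂ : V → V'), A ⊆ B → y ∈ B → (∀ a ∈ A, h₂ a = h a) →
      ∀ i : Fin (n + 1), (Fin.snoc v y : Fin (n + 1) → V) i ∈ B ∧
        h₂ ((Fin.snoc v y : Fin (n + 1) → V) i) = (Fin.snoc v' (h₂ y) : Fin (n + 1) → V') i := by
    intro B h₂ hAB hyB hag i
    refine Fin.lastCases ?_ (fun j => ?_) i
    · simp [hyB]
    · simp only [Fin.snoc_castSucc]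
      exact ⟨hAB (hv j).1, (hag _ (hv j).1).trans (hv j).2⟩
  by_cases hyA : y ∈ A
  · exact ⟨h y, A, h, hiso, hcl.mono (by omega), hcl'.mono (by omega), by omega,
      finish A h subset_rfl hyA fun _ _ => rfl⟩
  by_cases hfree : FreeOver G (2 ^ r) A y
  · have hcard := Finset.card_image_le (s := A) (f := h)
    obtain ⟨y', hyA', hfree'⟩ := hG'.exists_freeOver hK hm hD hpos hr hcl' (by omega)
    have hne : ∀ a ∈ A, h a ≠ y' := fun a ha hc => hyA' (hc ▸ Finset.mem_image_of_mem _ ha)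
    have hnadj := (degIn_eq_zero_iff _ _ _).1 (hfree.degIn_eq_zero hcl hpos hyA)
    have hnadj' := (degIn_eq_zero_iff _ _ _).1 (hfree'.degIn_eq_zero hcl' hpos hyA')
    have hag : ∀ a ∈ A, Function.update h y y' a = h a := fun a ha =>
      Function.update_of_ne (ne_of_mem_of_not_mem ha hyA) _ _
    have hfin := finish (insert y A) (Function.update h y y') (Finset.subset_insert _ _)
      (Finset.mem_insert_self _ _) hag
    rw [Function.update_self] at hfin
    refine ⟨y', insert y A, Function.update h y y', hiso.insert hyA hne fun a ha =>
      iff_of_false (hnadj a ha) (hnadj' _ (Finset.mem_image_of_mem _ ha)),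
      hfree.closedUpTo hcl hyA, ?_, ?_, hfin⟩
    · rw [Finset.image_insert, Function.update_self, Finset.image_congr fun a ha => hag a ha]
      exact hfree'.closedUpTo hcl' hyA'
    · rw [Finset.card_insert_of_notMem hyA]
      omega
  · unfold FreeOver at hfree
    push Not at hfree
    obtain ⟨S, hyS, hAS, hSc, he⟩ := hfree
    obtain ⟨h₂, hag, hiso₂⟩ := hG'.exists_extension hn₀ hD hr hiso hcl hcl' (by omega) S.card S rfl
      hAS hSc he
    have himgA : A.image h₂ = A.image h := Finset.image_congr fun a ha => hag a ha
    refine ⟨h₂ y, A ∪ S, h₂, hiso₂, hcl.union hAS hSc he.ge, ?_, ?_,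
      finish _ h₂ Finset.subset_union_left (Finset.mem_union_right _ hyS) hag⟩
    · have hcS : (S.image h₂).card = S.card :=
        Finset.card_image_of_injOn (hiso₂.1.mono (by simp))
      have hdisj : Disjoint (A.image h₂) (S.image h₂) := by
        rw [Finset.disjoint_left]
        intro w hw hw'
        obtain ⟨a, ha, rfl⟩ := Finset.mem_image.1 hw
        obtain ⟨b, hb, hab⟩ := Finset.mem_image.1 hw'
        have := hiso₂.1 (by simp [hb]) (by simp [ha]) hab
        exact Finset.disjoint_left.1 hAS ha (this ▸ hb)
      rw [Finset.image_union]
      refine ClosedUpTo.union (by rwa [himgA]) hdisj (by omega) ?_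
      rw [← Finset.image_union, hiso₂.numEdges_image,
        (hiso₂.mono Finset.subset_union_left).numEdges_image, hcS, he]
    · have := Finset.card_union_le A S
      omega

theorem Matched.duplicatorWins (hG : IsGood G D s M m K n₀) (hG' : IsGood G' D s M m K n₀)
    (hn₀ : (M + 1) * s ≤ n₀) (hK : M + m * s ≤ K) (hm : D * M < m * (D - s)) (hD : 1 < D) {r : ℕ}
    (hr : 2 ^ r ≤ s) : ∀ {n : ℕ} {v : Fin (n + 1) → V} {v' : Fin (n + 1) → V'},
      Matched G G' M r v v' → DuplicatorWins G G' r v v' := by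
  induction r with
  | zero => exact fun h => h.sameAtoms
  | succ r ih =>
    intro n v v' h
    have hr' : 2 ^ r ≤ s := le_trans (Nat.pow_le_pow_right (by norm_num) r.le_succ) hr
    refine ⟨h.sameAtoms, fun a => ?_, fun b => ?_⟩
    · obtain ⟨b, hb⟩ := h.forth hG' hn₀ hK hm hD hr' a
      exact ⟨b, ih hr' hb⟩
    · obtain ⟨a, ha⟩ := h.symm.forth hG hn₀ hK hm hD hr' b
      exact ⟨a, ih hr' ha.symm⟩

/-- The closed ear set around `x` has only subsets of positive weight, so `copies` supplies an
induced copy that is itself closed at scale `s`. -/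
theorem IsGood.exists_matched {k M₀ : ℕ} {β : ℝ} (hG : IsGood G D s M m K n₀)
    (hG' : IsGood G' D s M m K n₀) (hβ : β ∈ Set.Ioi (0 : ℝ) \ fractions k)
    (hs : s = 2 ^ (k - 1)) (hD : D = s + β) (hM₀ : ((s : ℝ) - 1) * (s / (D - s)) + s ≤ M₀)
    (hM : M₀ + s ≤ M) (hMK : M ≤ K) (hn₀ : M ≤ n₀) (x : V) :
    ∃ x', Matched G G' M (k - 1) (Fin.snoc Fin.elim0 x : Fin 1 → V)
      (Fin.snoc Fin.elim0 x' : Fin 1 → V') := by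
  have hs1 : 1 ≤ s := by
    rw [hs]
    exact Nat.one_le_two_pow
  have hβ0 : 0 < β := hβ.1
  have hs1' : (1 : ℝ) ≤ s := by exact_mod_cast hs1
  have hsp : ∀ W : Finset V, W.card ≤ K → (D - 1) * numEdges G W ≤ D * W.card := fun W hW =>
    hG.numEdges_le (by linarith) hW
  obtain ⟨T, hT, hTc, hcl⟩ := exists_closed_isEarSet hs1 (by linarith) hM₀ (hM.trans hMK) hsp x
  have hval : ∀ I : Finset T, IsoOn (G.comap (Subtype.val : T → V)) G Subtype.val I := fun I =>
    ⟨Subtype.val_injective.injOn, fun a _ b _ => Iff.rfl⟩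
  obtain ⟨f, hf, hfcl⟩ := hG'.exists_copy (ι := T) (by rw [Fintype.card_coe]; omega)
    (G.comap Subtype.val) (fun I hI => by
      rw [← (hval I).numEdges_image, ← Finset.card_image_of_injective I Subtype.val_injective]
      refine hT.weight_pos hβ hs hD (by omega) hsp hTc ?_ (hI.image _)
      intro v hv
      obtain ⟨u, -, rfl⟩ := Finset.mem_image.1 hv
      exact u.2)
  -- Only values on `T` matter; the image of `x` is an available default.
  let h : V → V' := fun v => if hv : v ∈ T then f ⟨v, hv⟩ else f ⟨x, hT.1⟩
  have hh : ∀ v (hv : v ∈ T), h v = f ⟨v, hv⟩ := fun v hv => dif_pos hv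
  refine ⟨h x, T, h, ⟨fun a ha b hb hab => ?_, fun a ha b hb => ?_⟩, by rwa [← hs], ?_, ?_, ?_⟩
  · rw [hh a ha, hh b hb] at hab
    simpa using f.injective hab
  · rw [hh a ha, hh b hb, hf]
    rfl
  · rw [← hs]
    convert hfcl using 1
    ext w
    simp only [Finset.mem_image, Finset.mem_univ, true_and, Subtype.exists]
    exact ⟨fun ⟨a, ha, hw⟩ => ⟨a, ha, by rw [← hh a ha, hw]⟩,
      fun ⟨a, ha, hw⟩ => ⟨a, ha, by rw [hh a ha, hw]⟩⟩
  · rw [← hs]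
    omega
  · intro i
    refine Fin.lastCases ?_ (fun j => j.elim0) i
    simp only [Fin.snoc_last]
    exact ⟨hT.1, trivial⟩

/-- Any two good graphs satisfy the same sentences of quantifier depth at most `k`. -/
theorem IsGood.satisfies_iff {k M₀ : ℕ} {β : ℝ} (hk : 1 ≤ k) (hG : IsGood G D s M m K n₀)
    (hG' : IsGood G' D s M m K n₀) (hβ : β ∈ Set.Ioi (0 : ℝ) \ fractions k)
    (hs : s = 2 ^ (k - 1)) (hD : D = s + β) (hM₀ : ((s : ℝ) - 1) * (s / (D - s)) + s ≤ M₀)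
    (hM : M₀ + s ≤ M) (hm : D * M < m * (D - s)) (hK : M + m * s ≤ K) (hn₀ : (M + 1) * s ≤ n₀)
    (φ : FirstOrder.Language.graph.Sentence) (hφ : φ.quantifierDepth ≤ k) :
    Satisfies G φ ↔ Satisfies G' φ := by
  have hs1 : 1 ≤ s := by
    rw [hs]
    exact Nat.one_le_two_pow
  have hβ0 : 0 < β := hβ.1
  have hs1' : (1 : ℝ) ≤ s := by exact_mod_cast hs1
  have hn₀' : M ≤ n₀ := by nlinarith
  have hMK : M ≤ K := by omega
  have hD1 : 1 < D := by linarith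
  refine DuplicatorWins.satisfies_iff (r := k) ?_ φ hφ
  obtain ⟨k, rfl⟩ : ∃ k', k = k' + 1 := ⟨k - 1, by omega⟩
  rw [Nat.add_sub_cancel] at hs
  refine ⟨fun i => i.elim0, fun a => ?_, fun b => ?_⟩
  · obtain ⟨b, hb⟩ := hG.exists_matched hG' hβ (by simpa using hs) hD hM₀ hM hMK hn₀' a
    exact ⟨b, hb.duplicatorWins hG hG' hn₀ hK hm hD1 (by simp [hs])⟩
  · obtain ⟨a, ha⟩ := hG'.exists_matched hG hβ (by simpa using hs) hD hM₀ hM hMK hn₀' b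
    exact ⟨a, ha.symm.duplicatorWins hG hG' hn₀ hK hm hD1 (by simp [hs])⟩

end Game

end ZeroOneLaw

namespace ZeroOneLaw

open MeasureTheory Measure ProbabilityTheory unitInterval

/-! ### Independence of edges in the binomial random graph. -/

section Basic

variable {V : Type} [Finite V]

theorem measurableSet_mem_edgeSet (e : Sym2 V) :
    MeasurableSet {G : SimpleGraph V | e ∈ G.edgeSet} := by
  induction e using Sym2.ind with
  | _ a b =>
    exact measurableSet_setOfPred.2 (SimpleGraph.measurable_iff_adj.1 measurable_id a b)

instance : MeasurableSingletonClass (SimpleGraph V) where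
  measurableSet_singleton G := by
    have h : ({G} : Set (SimpleGraph V)) = ⋂ e : Sym2 V, {G' | e ∈ G'.edgeSet ↔ e ∈ G.edgeSet} := by
      ext G'
      simp only [Set.mem_singleton_iff, Set.mem_iInter, Set.mem_ofPred_eq]
      exact ⟨fun h e => by rw [h], fun h => SimpleGraph.edgeSet_injective (Set.ext h)⟩
    rw [h]
    refine MeasurableSet.iInter fun e => ?_
    by_cases he : e ∈ G.edgeSet
    · simpa [he] using measurableSet_mem_edgeSet e
    · simp only [he, iff_false]
      exact (measurableSet_mem_edgeSet e).compl

/-- Passing to the product measure turns prescribed edges or non-edges into boxes, whose measure is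
a product. -/
theorem binomialRandom_apply_fromEdgeSet (p : I) (S : Set (SimpleGraph V)) :
    SimpleGraph.binomialRandom V p S = infinitePi
      (fun e : Sym2 V ↦ toNNReal p • dirac (e ∈ (Sym2.diagSetᶜ : Set (Sym2 V))) +
        toNNReal (σ p) • dirac False)
      {q | SimpleGraph.fromEdgeSet {e | q e} ∈ S} := by
  rw [SimpleGraph.binomialRandom_eq_map, Measure.map_apply (by fun_prop) S.toFinite.measurableSet,
    setBernoulli_apply']
  rfl

theorem real_edges_subset (p : I) (F : Finset (Sym2 V)) (hF : ∀ e ∈ F, ¬ e.IsDiag) :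
    (SimpleGraph.binomialRandom V p).real {G | ∀ e ∈ F, e ∈ G.edgeSet} = (p : ℝ) ^ F.card := by
  have h : {q : Sym2 V → Prop | SimpleGraph.fromEdgeSet {e | q e} ∈
      {G : SimpleGraph V | ∀ e ∈ F, e ∈ G.edgeSet}} = Set.pi F fun _ => {True} := by
    ext q
    simp only [Set.mem_ofPred_eq, Set.mem_pi, Finset.mem_coe, Set.mem_singleton_iff, eq_iff_iff,
      iff_true, SimpleGraph.edgeSet_fromEdgeSet, Set.mem_sdiff]
    exact ⟨fun h e he => (h e he).1, fun h e he => ⟨h e he, hF e he⟩⟩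
  rw [measureReal_def, binomialRandom_apply_fromEdgeSet, h,
    infinitePi_pi _ fun _ _ => MeasurableSet.of_discrete]
  rw [Finset.prod_congr rfl (g := fun _ => ((toNNReal p : NNReal) : ENNReal)), Finset.prod_const]
  · simp
  · intro e he
    simp [hF e he]

theorem real_edges_disjoint (p : I) (F : Finset (Sym2 V)) (hF : ∀ e ∈ F, ¬ e.IsDiag) :
    (SimpleGraph.binomialRandom V p).real {G | ∀ e ∈ F, e ∉ G.edgeSet} =
      (1 - p : ℝ) ^ F.card := by
  have h : {q : Sym2 V → Prop | SimpleGraph.fromEdgeSet {e | q e} ∈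
      {G : SimpleGraph V | ∀ e ∈ F, e ∉ G.edgeSet}} = Set.pi F fun _ => {False} := by
    ext q
    simp only [Set.mem_ofPred_eq, Set.mem_pi, Finset.mem_coe, Set.mem_singleton_iff, eq_iff_iff,
      iff_false, SimpleGraph.edgeSet_fromEdgeSet, Set.mem_sdiff]
    exact ⟨fun h e he hq => h e he ⟨hq, hF e he⟩, fun h e he hq => h e he hq.1⟩
  rw [measureReal_def, binomialRandom_apply_fromEdgeSet, h,
    infinitePi_pi _ fun _ _ => MeasurableSet.of_discrete]
  rw [Finset.prod_congr rfl (g := fun _ => ((toNNReal (σ p) : NNReal) : ENNReal)),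
    Finset.prod_const]
  · simp
  · intro e he
    simp [hF e he]

end Basic

/-! ### Probabilities of copies of a fixed graph. -/

section Copies

variable {V ι : Type} [Fintype ι] [DecidableEq ι] [DecidableEq V]

open Classical in
/-- The edges of `K`, transported along `f`. -/
noncomputable def edgeImage (K : SimpleGraph ι) (f : ι → V) : Finset (Sym2 V) :=
  ((Finset.univ.sym2.filter (· ∈ K.edgeSet)).image (Sym2.map f))

/-- The graphs containing the copy of `K` given by the map `f`, which is required to be injective. -/
def copyEvent (K : SimpleGraph ι) (f : ι → V) : Set (SimpleGraph V) :=
  {G | Function.Injective f ∧ ∀ i j, K.Adj i j → G.Adj (f i) (f j)}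

theorem mem_edgeImage {K : SimpleGraph ι} {f : ι → V} {e : Sym2 V} :
    e ∈ edgeImage K f ↔ ∃ i j, K.Adj i j ∧ s(f i, f j) = e := by
  classical
  simp only [edgeImage, Finset.mem_image, Finset.mem_filter]
  constructor
  · rintro ⟨e', ⟨-, he'⟩, rfl⟩
    induction e' using Sym2.ind with
    | _ a b => exact ⟨a, b, he', rfl⟩
  · rintro ⟨i, j, hij, rfl⟩
    exact ⟨s(i, j), ⟨by simp, hij⟩, rfl⟩

theorem card_edgeImage (K : SimpleGraph ι) {f : ι → V} (hf : Function.Injective f) :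
    (edgeImage K f).card = numEdges K Finset.univ := by
  classical
  rw [edgeImage, Finset.card_image_of_injective _ (Sym2.map.injective hf)]
  rfl

theorem not_isDiag_of_mem_edgeImage {K : SimpleGraph ι} {f : ι → V} (hf : Function.Injective f)
    {e : Sym2 V} (he : e ∈ edgeImage K f) : ¬ e.IsDiag := by
  obtain ⟨i, j, hij, rfl⟩ := mem_edgeImage.1 he
  simpa using fun h => hij.ne (hf h)

theorem copyEvent_eq (K : SimpleGraph ι) {f : ι → V} (hf : Function.Injective f) :
    copyEvent K f = {G | ∀ e ∈ edgeImage K f, e ∈ G.edgeSet} := by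
  ext G
  simp only [copyEvent, Set.mem_ofPred_eq, hf, true_and, mem_edgeImage]
  constructor
  · rintro h _ ⟨i, j, hij, rfl⟩
    exact h i j hij
  · exact fun h i j hij => h _ ⟨i, j, hij, rfl⟩

theorem real_copyEvent [Finite V] (p : I) (K : SimpleGraph ι) {f : ι → V}
    (hf : Function.Injective f) :
    (SimpleGraph.binomialRandom V p).real (copyEvent K f) = (p : ℝ) ^ numEdges K Finset.univ := by
  rw [copyEvent_eq K hf, real_edges_subset p _ fun e he => not_isDiag_of_mem_edgeImage hf he,
    card_edgeImage K hf]

theorem real_copyEvent_le [Finite V] (p : I) (K : SimpleGraph ι) (f : ι → V) :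
    (SimpleGraph.binomialRandom V p).real (copyEvent K f) ≤ (p : ℝ) ^ numEdges K Finset.univ := by
  by_cases hf : Function.Injective f
  · exact (real_copyEvent p K hf).le
  · have : copyEvent K f = ∅ := by
      ext G
      simp [copyEvent, hf]
    rw [this, measureReal_empty]
    exact pow_nonneg p.2.1 _

/-- Two copies of `H` share at most the edges of `H` inside the common vertices. -/
theorem real_copyEvent_inter_le [Finite V] (p : I) (H : SimpleGraph ι) {f g : ι → V}
    (hf : Function.Injective f) (hg : Function.Injective g) (J : Finset ι)
    (hJ : ∀ i, (∃ j, g j = f i) → i ∈ J) :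
    (SimpleGraph.binomialRandom V p).real (copyEvent H f ∩ copyEvent H g) ≤
      (p : ℝ) ^ (2 * numEdges H Finset.univ - numEdges H J) := by
  classical
  have h1 : copyEvent H f ∩ copyEvent H g =
      {G | ∀ e ∈ edgeImage H f ∪ edgeImage H g, e ∈ G.edgeSet} := by
    ext G
    rw [copyEvent_eq H hf, copyEvent_eq H hg]
    simp only [Set.mem_inter_iff, Set.mem_ofPred_eq, Finset.mem_union]
    exact ⟨fun h e he => he.elim (h.1 e) (h.2 e),
      fun h => ⟨fun e he => h e (Or.inl he), fun e he => h e (Or.inr he)⟩⟩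
  rw [h1, real_edges_subset]
  · refine pow_le_pow_of_le_one p.2.1 p.2.2 ?_
    have h2 := Finset.card_union_add_card_inter (edgeImage H f) (edgeImage H g)
    rw [card_edgeImage H hf, card_edgeImage H hg] at h2
    have h3 : (edgeImage H f ∩ edgeImage H g).card ≤ numEdges H J := by
      rw [numEdges, ← Finset.card_image_of_injective _ (Sym2.map.injective hf)]
      refine Finset.card_le_card fun e he => ?_
      rw [Finset.mem_inter, mem_edgeImage, mem_edgeImage] at he
      obtain ⟨⟨i, j, hij, rfl⟩, i', j', -, he⟩ := he
      refine Finset.mem_image.2 ⟨s(i, j), Finset.mem_filter.2 ⟨?_, hij⟩, rfl⟩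
      rw [Finset.mk_mem_sym2_iff]
      rcases Sym2.eq_iff.1 he with ⟨h1, h2⟩ | ⟨h1, h2⟩
      · exact ⟨hJ i ⟨i', h1⟩, hJ j ⟨j', h2⟩⟩
      · exact ⟨hJ i ⟨j', h2⟩, hJ j ⟨i', h1⟩⟩
    omega
  · intro e he
    rcases Finset.mem_union.1 he with he | he
    · exact not_isDiag_of_mem_edgeImage hf he
    · exact not_isDiag_of_mem_edgeImage hg he

theorem numEdges_image_univ (G : SimpleGraph V) {f : ι → V} (hf : Function.Injective f) :
    numEdges G (Finset.univ.image f) = numEdges (G.comap f) Finset.univ :=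
  IsoOn.numEdges_image (G := G.comap f) ⟨hf.injOn, fun _ _ _ _ => Iff.rfl⟩

/-- A set disjoint from the range of `y` is parametrized together with that range. -/
theorem exists_parametrization (G : SimpleGraph V) {y : ι → V} (hy : Function.Injective y)
    {W : Finset V} (hW : Disjoint (Finset.univ.image y) W) :
    ∃ g : Fin W.card → V, Function.Injective (Sum.elim y g) ∧
      numEdges (G.comap (Sum.elim y g)) Finset.univ = numEdges G (Finset.univ.image y ∪ W) := by
  let g : Fin W.card → V := fun i => W.equivFin.symm i
  have hgW : ∀ i, g i ∈ W := fun i => (W.equivFin.symm i).2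
  have hginj : Function.Injective g := Subtype.val_injective.comp W.equivFin.symm.injective
  have hinj : Function.Injective (Sum.elim y g) := by
    refine Sum.elim_injective.2 ⟨hy, hginj, fun i j hij => ?_⟩
    exact Finset.disjoint_left.1 hW (Finset.mem_image_of_mem y (Finset.mem_univ i)) (hij ▸ hgW j)
  refine ⟨g, hinj, ?_⟩
  rw [← numEdges_image_univ G hinj]
  congr 1
  ext v
  simp only [Finset.mem_image, Finset.mem_univ, true_and, Sum.exists, Sum.elim_inl, Sum.elim_inr,
    Finset.mem_union]
  refine or_congr Iff.rfl ⟨fun ⟨i, hi⟩ => hi ▸ hgW i, fun hv => ⟨W.equivFin ⟨v, hv⟩, by simp [g]⟩⟩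

theorem numEdges_le_of_le {H H' : SimpleGraph V} (h : H ≤ H') (S : Finset V) :
    numEdges H S ≤ numEdges H' S := by
  classical
  refine Finset.card_le_card fun e he => ?_
  rw [Finset.mem_filter] at he ⊢
  exact ⟨he.1, SimpleGraph.edgeSet_mono h he.2⟩

theorem numEdges_univ_lt_of_lt {H H' : SimpleGraph ι} (h : H < H') :
    numEdges H Finset.univ < numEdges H' Finset.univ := by
  classical
  obtain ⟨hle, hne⟩ := lt_iff_le_not_ge.1 h
  refine Finset.card_lt_card (Finset.ssubset_iff_subset_ne.2 ⟨fun e he => ?_, fun heq => hne ?_⟩)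
  · rw [Finset.mem_filter] at he ⊢
    exact ⟨he.1, SimpleGraph.edgeSet_mono hle he.2⟩
  · intro i j hij
    have : s(i, j) ∈ Finset.univ.sym2.filter (· ∈ H.edgeSet) := by
      rw [heq]
      exact Finset.mem_filter.2 ⟨by simp, hij⟩
    exact (Finset.mem_filter.1 this).2

end Copies

/-! ### A second moment inequality. -/

section SecondMoment

/-- A second moment bound on the probability that the number of events `E i` which occur does not
exceed the number of events `B j` which occur. -/
theorem real_sum_indicator_le {Ω ι κ : Type*} [MeasurableSpace Ω] [Finite Ω]
    [MeasurableSingletonClass Ω] (μ : Measure Ω) [IsProbabilityMeasure μ] (T : Finset ι)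
    (E : ι → Set Ω) (J : Finset κ) (B : κ → Set Ω) {a : ℝ} (ha : 0 < a)
    (hE : ∑ i ∈ T, μ.real (E i) = a) :
    μ.real {ω | ∑ i ∈ T, (E i).indicator (1 : Ω → ℝ) ω ≤ ∑ j ∈ J, (B j).indicator (1 : Ω → ℝ) ω} ≤
      4 / a ^ 2 * (∑ i ∈ T, ∑ j ∈ T, μ.real (E i ∩ E j) - a ^ 2) +
        2 / a * ∑ j ∈ J, μ.real (B j) := by
  classical
  have hint : ∀ f : Ω → ℝ, Integrable f μ := fun f => Integrable.of_finite
  have hind : ∀ S : Set Ω, ∫ ω, S.indicator (1 : Ω → ℝ) ω ∂μ = μ.real S := fun S =>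
    integral_indicator_one S.toFinite.measurableSet
  set X : Ω → ℝ := fun ω => ∑ i ∈ T, (E i).indicator (1 : Ω → ℝ) ω with hX
  set Y : Ω → ℝ := fun ω => ∑ j ∈ J, (B j).indicator (1 : Ω → ℝ) ω with hY
  have hXint : ∫ ω, X ω ∂μ = a := by
    rw [hX, integral_finsetSum _ fun i _ => hint _, ← hE]
    exact Finset.sum_congr rfl fun i _ => hind _
  have hYint : ∫ ω, Y ω ∂μ = ∑ j ∈ J, μ.real (B j) := by
    rw [hY, integral_finsetSum _ fun i _ => hint _]
    exact Finset.sum_congr rfl fun i _ => hind _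
  have hX2 : ∫ ω, X ω ^ 2 ∂μ = ∑ i ∈ T, ∑ j ∈ T, μ.real (E i ∩ E j) := by
    have : (fun ω => X ω ^ 2) =
        fun ω => ∑ i ∈ T, ∑ j ∈ T, (E i ∩ E j).indicator (1 : Ω → ℝ) ω := by
      funext ω
      rw [sq, hX, Finset.sum_mul_sum]
      refine Finset.sum_congr rfl fun i _ => Finset.sum_congr rfl fun j _ => ?_
      rw [Set.inter_indicator_one]
      rfl
    rw [this, integral_finsetSum _ fun i _ => hint _]
    refine Finset.sum_congr rfl fun i _ => ?_
    rw [integral_finsetSum _ fun i _ => hint _]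
    exact Finset.sum_congr rfl fun j _ => hind _
  have hYnn : ∀ ω, 0 ≤ Y ω := fun ω =>
    Finset.sum_nonneg fun j _ => Set.indicator_nonneg (fun _ _ => zero_le_one) _
  -- If `X ≤ Y`, either `X ≤ a/2`, where the Chebyshev term is at least 1, or `Y ≥ a/2`, where the
  -- Markov term is.
  have hpt : ∀ ω, {ω | X ω ≤ Y ω}.indicator (1 : Ω → ℝ) ω ≤
      4 / a ^ 2 * (X ω - a) ^ 2 + 2 / a * Y ω := by
    intro ω
    have h1 : 0 ≤ 4 / a ^ 2 * (X ω - a) ^ 2 := by positivity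
    have h2 : 0 ≤ 2 / a * Y ω := mul_nonneg (by positivity) (hYnn ω)
    by_cases hω : X ω ≤ Y ω
    · rw [Set.indicator_of_mem (by exact hω), Pi.one_apply]
      rcases le_total (X ω) (a / 2) with h | h
      · have h3 : 1 ≤ 4 / a ^ 2 * (X ω - a) ^ 2 := by
          rw [div_mul_eq_mul_div, le_div_iff₀ (by positivity)]
          nlinarith
        linarith
      · have h3 : 1 ≤ 2 / a * Y ω := by
          rw [div_mul_eq_mul_div, le_div_iff₀ ha]
          linarith
        linarith
    · rw [Set.indicator_of_notMem (by exact hω)]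
      linarith
  calc μ.real {ω | X ω ≤ Y ω} = ∫ ω, {ω | X ω ≤ Y ω}.indicator (1 : Ω → ℝ) ω ∂μ := (hind _).symm
    _ ≤ ∫ ω, (4 / a ^ 2 * (X ω - a) ^ 2 + 2 / a * Y ω) ∂μ :=
      integral_mono (hint _) (hint _) hpt
    _ = 4 / a ^ 2 * (∫ ω, (X ω ^ 2 - 2 * a * X ω + a ^ 2) ∂μ) + 2 / a * ∫ ω, Y ω ∂μ := by
      rw [integral_add (hint _) (hint _), integral_const_mul, integral_const_mul]
      congr 3
      funext ω
      ring
    _ = _ := by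
      rw [integral_add (hint _) (hint _), integral_sub (hint _) (hint _), integral_const_mul, hXint,
        hYint, hX2, integral_const]
      simp only [probReal_univ, one_smul]
      ring

end SecondMoment

/-! ### Asymptotics of powers of `N` and of the edge probability. -/

section Rates

variable {α : ℝ}

theorem tendsto_sum_zero {ι : Type*} (T : Finset ι) {f : ι → ℕ → ℝ}
    (h : ∀ i ∈ T, Tendsto (f i) atTop (𝓝 0)) :
    Tendsto (fun N => ∑ i ∈ T, f i N) atTop (𝓝 0) := by
  simpa using tendsto_finsetSum T h

theorem edgeProb_pos (hα : 0 ≤ α) {N : ℕ} (hN : 1 ≤ N) : (0 : ℝ) < edgeProb α N := by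
  rw [coe_edgeProb hα]
  exact Real.rpow_pos_of_pos (by exact_mod_cast hN) _

theorem pow_mul_edgeProb_pow (hα : 0 ≤ α) (a b : ℕ) {N : ℕ} (hN : 1 ≤ N) :
    (N : ℝ) ^ a * (edgeProb α N : ℝ) ^ b = (N : ℝ) ^ (a - α * b : ℝ) := by
  have hN' : (0 : ℝ) < N := by exact_mod_cast hN
  rw [coe_edgeProb hα, ← Real.rpow_natCast, ← Real.rpow_natCast, ← Real.rpow_mul hN'.le,
    ← Real.rpow_add hN']
  ring_nf

theorem tendsto_pow_mul_edgeProb_pow (hα : 0 ≤ α) {a b : ℕ} (h : (a : ℝ) < α * b) :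
    Tendsto (fun N : ℕ => (N : ℝ) ^ a * (edgeProb α N : ℝ) ^ b) atTop (𝓝 0) := by
  have h1 := (tendsto_rpow_neg_atTop (sub_pos.2 h)).comp (tendsto_natCast_atTop_atTop (R := ℝ))
  refine h1.congr' ?_
  filter_upwards [eventually_ge_atTop 1] with N hN
  rw [pow_mul_edgeProb_pow hα a b hN, Function.comp_apply, neg_sub]

theorem tendsto_inv_pow_mul_edgeProb_pow (hα : 0 ≤ α) {a b : ℕ} (h : α * b < a) :
    Tendsto (fun N : ℕ => ((N : ℝ) ^ a * (edgeProb α N : ℝ) ^ b)⁻¹) atTop (𝓝 0) := by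
  have h1 := (tendsto_rpow_neg_atTop (sub_pos.2 h)).comp (tendsto_natCast_atTop_atTop (R := ℝ))
  refine h1.congr' ?_
  filter_upwards [eventually_ge_atTop 1] with N hN
  rw [pow_mul_edgeProb_pow hα a b hN, Function.comp_apply, Real.rpow_neg (Nat.cast_nonneg N)]

theorem tendsto_pow_mul_exp_edgeProb (hα : 0 ≤ α) (hα1 : α < 1) (M : ℕ) :
    Tendsto (fun N : ℕ => (N : ℝ) ^ (M + 1) *
      Real.exp (-((edgeProb α N : ℝ) * (N - (M + 1) : ℝ)))) atTop (𝓝 0) := by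
  have hγ : 0 < 1 - α := by linarith
  -- In the variable `x = N^(1-α) = N p` the bound becomes `x^((M+1)/(1-α)) exp(-x/2)`; the half
  -- absorbs the subtracted `M + 1` once `N ≥ 2(M+1)`.
  have h1 := (tendsto_rpow_mul_exp_neg_mul_atTop_nhds_zero (((M + 1 : ℕ) : ℝ) / (1 - α)) (1 / 2)
    (by norm_num)).comp ((tendsto_rpow_atTop hγ).comp (tendsto_natCast_atTop_atTop (R := ℝ)))
  refine squeeze_zero' (.of_forall fun N => by positivity) ?_ h1
  filter_upwards [eventually_ge_atTop (2 * (M + 1))] with N hN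
  have hN' : (2 : ℝ) * (M + 1) ≤ N := by exact_mod_cast hN
  have hN0 : (0 : ℝ) < N := by
    have : (0 : ℝ) ≤ M := Nat.cast_nonneg M
    linarith
  simp only [Function.comp_apply]
  rw [← Real.rpow_mul hN0.le, mul_div_cancel₀ _ hγ.ne', Real.rpow_natCast]
  refine mul_le_mul_of_nonneg_left (Real.exp_le_exp.2 ?_) (by positivity)
  have h2 : (N : ℝ) ^ (1 - α) = N * edgeProb α N := by
    rw [coe_edgeProb hα, sub_eq_add_neg, Real.rpow_add hN0, Real.rpow_one]
  rw [h2]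
  have h3 : (0 : ℝ) ≤ edgeProb α N := (edgeProb α N).2.1
  nlinarith

end Rates

/-! ### Sparsity relative to a fixed set of vertices. -/

section Sparse

-- Take for `Y` the first `m` vertices. They are fixed in advance, so a violating graph on `Y ∪ W`
-- has only `N^t` placements, with `t = |W|`, and a union bound suffices.
open Classical in
theorem real_not_sparse_le (p : I) {D : ℝ} {m K N : ℕ} (hN : m ≤ N) :
    (SimpleGraph.binomialRandom (Fin N) p).real {G | ¬ ∃ Y : Finset (Fin N), Y.card = m ∧
      ∀ W : Finset (Fin N), Disjoint Y W → W.card ≤ K →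
        (D - 1) * numEdges G (Y ∪ W) ≤ D * W.card} ≤
    ∑ t ∈ Finset.range (K + 1), ∑ H : SimpleGraph (Fin m ⊕ Fin t),
      if D * t < (D - 1) * numEdges H Finset.univ then
        (N : ℝ) ^ t * (p : ℝ) ^ numEdges H Finset.univ else 0 := by
  let y : Fin m → Fin N := Fin.castLE hN
  have hy : Function.Injective y := Fin.castLE_injective hN
  have hsub : {G : SimpleGraph (Fin N) | ¬ ∃ Y : Finset (Fin N), Y.card = m ∧
      ∀ W : Finset (Fin N), Disjoint Y W → W.card ≤ K →
        (D - 1) * numEdges G (Y ∪ W) ≤ D * W.card} ⊆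
      ⋃ t ∈ Finset.range (K + 1), ⋃ H ∈ (Finset.univ : Finset (SimpleGraph (Fin m ⊕ Fin t))).filter
        (fun H => D * t < (D - 1) * numEdges H Finset.univ),
        ⋃ g ∈ (Finset.univ : Finset (Fin t → Fin N)), copyEvent H (Sum.elim y g) := by
    intro G hG
    simp only [Set.mem_ofPred_eq, not_exists, not_and] at hG
    have h1 := hG (Finset.univ.image y) (by
      rw [Finset.card_image_of_injective _ hy, Finset.card_univ, Fintype.card_fin])
    push Not at h1
    obtain ⟨W, hd, hWK, hW⟩ := h1
    obtain ⟨g, hinj, hg⟩ := exists_parametrization G hy hd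
    simp only [Set.mem_iUnion, Finset.mem_range, Finset.mem_filter, Finset.mem_univ, true_and]
    refine ⟨W.card, by omega, G.comap (Sum.elim y g), ?_, g, trivial, hinj, fun i j hij => hij⟩
    rw [hg]
    exact hW
  refine (measureReal_mono hsub (measure_ne_top _ _)).trans ((measureReal_biUnion_finset_le _ _).trans ?_)
  refine Finset.sum_le_sum fun t _ => (measureReal_biUnion_finset_le _ _).trans ?_
  rw [Finset.sum_filter]
  refine Finset.sum_le_sum fun H _ => ?_
  split_ifs
  · refine (measureReal_biUnion_finset_le _ _).trans ?_
    refine (Finset.sum_le_card_nsmul _ _ _ fun g _ => real_copyEvent_le p H _).trans ?_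
    simp
  · exact le_rfl

theorem tendsto_not_sparse {α D : ℝ} (hD : 1 < D) (hα : α = 1 - 1 / D) (m K : ℕ) :
    Tendsto (fun N : ℕ => (SimpleGraph.binomialRandom (Fin N) (edgeProb α N)).real
      {G | ¬ ∃ Y : Finset (Fin N), Y.card = m ∧
        ∀ W : Finset (Fin N), Disjoint Y W → W.card ≤ K →
          (D - 1) * numEdges G (Y ∪ W) ≤ D * W.card}) atTop (𝓝 0) := by
  classical
  have hα0 : 0 ≤ α := by
    rw [hα, sub_nonneg, div_le_one (by linarith)]
    exact hD.le
  refine squeeze_zero' (.of_forall fun N => measureReal_nonneg)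
    ((eventually_ge_atTop m).mono fun N hN => real_not_sparse_le _ hN) ?_
  refine tendsto_sum_zero _ fun t _ => tendsto_sum_zero _ fun H _ => ?_
  split_ifs with h
  · refine tendsto_pow_mul_edgeProb_pow hα0 ?_
    rw [hα, show (1 : ℝ) - 1 / D = (D - 1) / D by field_simp, div_mul_eq_mul_div,
      lt_div_iff₀ (by linarith)]
    linarith
  · exact tendsto_const_nhds

end Sparse

/-! ### Every vertex has neighbours outside any bounded set. -/

section Degree

theorem real_not_degree_le (p : I) (M N : ℕ) (hN : 1 ≤ N) :
    (SimpleGraph.binomialRandom (Fin N) p).real {G | ¬ ∀ (v : Fin N) (A : Finset (Fin N)),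
      A.card ≤ M → ∃ u ∉ A, G.Adj v u} ≤
    (N : ℝ) ^ (M + 1) * Real.exp (-((p : ℝ) * (N - (M + 1) : ℝ))) := by
  classical
  let F : Fin N → (Fin M → Fin N) → Finset (Sym2 (Fin N)) := fun v t =>
    (Finset.univ \ insert v (Finset.univ.image t)).image fun u => s(v, u)
  have hF : ∀ v t, ∀ e ∈ F v t, ¬ e.IsDiag := by
    intro v t e he
    obtain ⟨u, hu, rfl⟩ := Finset.mem_image.1 he
    simp only [Finset.mem_sdiff, Finset.mem_insert, not_or] at hu
    simpa using fun h => hu.2.1 (Eq.symm h)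
  have hFc : ∀ v t, N - (M + 1) ≤ (F v t).card := by
    intro v t
    rw [Finset.card_image_of_injective _ (fun a b hab => by
      rcases Sym2.eq_iff.1 hab with h | h
      · exact h.2
      · exact h.2.trans h.1)]
    have h1 := Finset.le_card_sdiff (insert v (Finset.univ.image t)) Finset.univ
    have h2 := Finset.card_insert_le v (Finset.univ.image t)
    have h3 := Finset.card_image_le (s := Finset.univ) (f := t)
    simp only [Finset.card_univ, Fintype.card_fin] at h1 h3
    omega
  have hsub : {G : SimpleGraph (Fin N) | ¬ ∀ (v : Fin N) (A : Finset (Fin N)),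
      A.card ≤ M → ∃ u ∉ A, G.Adj v u} ⊆
      ⋃ v ∈ (Finset.univ : Finset (Fin N)), ⋃ t ∈ (Finset.univ : Finset (Fin M → Fin N)),
        {G | ∀ e ∈ F v t, e ∉ G.edgeSet} := by
    intro G hG
    simp only [Set.mem_ofPred_eq] at hG
    push Not at hG
    obtain ⟨v, A, hA, hv⟩ := hG
    simp only [Set.mem_iUnion, Finset.mem_univ, exists_true_left]
    -- `A` is padded by the vertex 0 to a tuple of length exactly `M`, so that `N^M` tuples cover
    -- all sets.
    let t : Fin M → Fin N := fun i =>
      if hi : (i : ℕ) < A.card then A.equivFin.symm ⟨i, hi⟩ else ⟨0, hN⟩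
    have ht : A ⊆ Finset.univ.image t := by
      intro a ha
      refine Finset.mem_image.2 ⟨⟨A.equivFin ⟨a, ha⟩, (A.equivFin ⟨a, ha⟩).2.trans_le hA⟩,
        Finset.mem_univ _, ?_⟩
      simp [t]
    refine ⟨v, t, fun e he => ?_⟩
    obtain ⟨u, hu, rfl⟩ := Finset.mem_image.1 he
    simp only [Finset.mem_sdiff, Finset.mem_insert, not_or] at hu
    exact hv u fun huA => hu.2.2 (ht huA)
  have hp0 : (0 : ℝ) ≤ 1 - p := by linarith [p.2.2]
  have hbound : ∀ v t, (SimpleGraph.binomialRandom (Fin N) p).real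
      {G | ∀ e ∈ F v t, e ∉ G.edgeSet} ≤ Real.exp (-((p : ℝ) * (N - (M + 1) : ℝ))) := by
    intro v t
    rw [real_edges_disjoint p _ (hF v t)]
    calc (1 - p : ℝ) ^ (F v t).card ≤ Real.exp (-p) ^ (F v t).card :=
          pow_le_pow_left₀ hp0 (Real.one_sub_le_exp_neg _) _
      _ = Real.exp (-((p : ℝ) * (F v t).card)) := by
          rw [← Real.exp_nat_mul]
          ring_nf
      _ ≤ _ := by
          refine Real.exp_le_exp.2 (neg_le_neg (mul_le_mul_of_nonneg_left ?_ p.2.1))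
          have h1 : N ≤ (F v t).card + (M + 1) := by have := hFc v t; omega
          have h2 : (N : ℝ) ≤ (F v t).card + (M + 1) := by exact_mod_cast h1
          linarith
  refine (measureReal_mono hsub (measure_ne_top _ _)).trans ((measureReal_biUnion_finset_le _ _).trans ?_)
  refine (Finset.sum_le_card_nsmul _ _ _ fun v _ => (measureReal_biUnion_finset_le _ _).trans
    (Finset.sum_le_card_nsmul _ _ _ fun t _ => hbound v t)).trans ?_
  simp only [Finset.card_univ, Fintype.card_fin, Fintype.card_pi, Finset.prod_const, nsmul_eq_mul,
    Nat.cast_pow]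
  rw [pow_succ]
  exact le_of_eq (by ring)

theorem tendsto_not_degree {α : ℝ} (hα : 0 ≤ α) (hα1 : α < 1) (M : ℕ) :
    Tendsto (fun N : ℕ => (SimpleGraph.binomialRandom (Fin N) (edgeProb α N)).real
      {G | ¬ ∀ (v : Fin N) (A : Finset (Fin N)), A.card ≤ M → ∃ u ∉ A, G.Adj v u})
      atTop (𝓝 0) :=
  squeeze_zero' (.of_forall fun _ => measureReal_nonneg)
    ((eventually_ge_atTop 1).mono fun N hN => real_not_degree_le _ M N hN)
    (tendsto_pow_mul_exp_edgeProb hα hα1 M)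

end Degree

/-! ### Induced copies with closed vertex set. -/

section ClosedCopies

theorem card_embedding_le_of_mem_range {n N : ℕ} (J : Finset (Fin n)) (g : Fin n → Fin N)
    [DecidablePred fun f : Fin n ↪ Fin N => ∀ i ∈ J, ∃ j, g j = f i] :
    ((Finset.univ : Finset (Fin n ↪ Fin N)).filter fun f => ∀ i ∈ J, ∃ j, g j = f i).card ≤
      n ^ J.card * N ^ (n - J.card) := by
  classical
  let T : Fin n → Finset (Fin N) := fun i => if i ∈ J then Finset.univ.image g else Finset.univ
  calc _ ≤ (Fintype.piFinset T).card := by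
        refine Finset.card_le_card_of_injOn (fun f => (f : Fin n → Fin N)) ?_
          (fun f _ f' _ h => DFunLike.coe_injective h)
        intro f hf
        have hf' := (Finset.mem_filter.1 hf).2
        refine Fintype.mem_piFinset.2 fun i => ?_
        by_cases hi : i ∈ J
        · obtain ⟨j, hj⟩ := hf' i hi
          simp only [T, hi, if_true]
          exact Finset.mem_image.2 ⟨j, Finset.mem_univ _, hj⟩
        · simp [T, hi]
    _ = ∏ i, (T i).card := Fintype.card_piFinset T
    _ ≤ ∏ i : Fin n, if i ∈ J then n else N := by
        refine Finset.prod_le_prod' fun i _ => ?_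
        by_cases hi : i ∈ J
        · simp only [T, hi, if_true]
          exact Finset.card_image_le.trans (by simp)
        · simp [T, hi]
    _ = n ^ J.card * N ^ (n - J.card) := by
        rw [Finset.prod_ite, Finset.prod_const, Finset.prod_const, Finset.filter_mem_eq_inter,
          Finset.univ_inter, Finset.filter_not, Finset.filter_mem_eq_inter, Finset.univ_inter,
          Finset.card_sdiff_of_subset (Finset.subset_univ _), Finset.card_univ, Fintype.card_fin]

theorem half_pow_le_card_embedding {n N : ℕ} (hN : 2 * n ≤ N) :
    ((N : ℝ) / 2) ^ n ≤ Fintype.card (Fin n ↪ Fin N) := by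
  rw [Fintype.card_embedding_eq, Fintype.card_fin, Fintype.card_fin]
  have h1 : (((N + 1 - n : ℕ) : ℝ)) ^ n ≤ (N.descFactorial n : ℝ) := by
    exact_mod_cast Nat.pow_sub_le_descFactorial N n
  refine le_trans (pow_le_pow_left₀ (by positivity) ?_ n) h1
  have h2 : N ≤ 2 * (N + 1 - n) := by omega
  have h3 : (N : ℝ) ≤ 2 * ((N + 1 - n : ℕ) : ℝ) := by exact_mod_cast h2
  linarith

open Classical in
/-- The covariances of the copies of `H` are controlled by the possible overlaps. -/
theorem sum_real_copyEvent_inter_le (p : I) {n N : ℕ} (H : SimpleGraph (Fin n)) :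
    ∑ f : Fin n ↪ Fin N, ∑ g : Fin n ↪ Fin N,
      (SimpleGraph.binomialRandom (Fin N) p).real (copyEvent H f ∩ copyEvent H g) -
        (Fintype.card (Fin n ↪ Fin N) * (p : ℝ) ^ numEdges H Finset.univ) ^ 2 ≤
    ∑ J : Finset (Fin n) with J.Nonempty, (N : ℝ) ^ n * ((n : ℝ) ^ J.card *
      (N : ℝ) ^ (n - J.card)) * (p : ℝ) ^ (2 * numEdges H Finset.univ - numEdges H J) := by
  set e := numEdges H Finset.univ
  have hp0 : (0 : ℝ) ≤ p := p.2.1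
  have hterm : ∀ f g : Fin n ↪ Fin N,
      (SimpleGraph.binomialRandom (Fin N) p).real (copyEvent H f ∩ copyEvent H g) ≤
        (p : ℝ) ^ (2 * e) + ∑ J : Finset (Fin n) with J.Nonempty,
          if ∀ i ∈ J, ∃ j, g j = f i then (p : ℝ) ^ (2 * e - numEdges H J) else 0 := by
    intro f g
    -- The exact overlap. An empty one gives the independent main term; otherwise its own summand
    -- suffices.
    let J₀ : Finset (Fin n) := Finset.univ.filter fun i => ∃ j, g j = f i
    have hJ₀ : ∀ i, (∃ j, g j = f i) → i ∈ J₀ := fun i hi =>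
      Finset.mem_filter.2 ⟨Finset.mem_univ _, hi⟩
    have h1 := real_copyEvent_inter_le p H f.injective g.injective J₀ hJ₀
    have hnn : ∀ J ∈ (Finset.univ : Finset (Finset (Fin n))).filter (fun J => J.Nonempty),
        0 ≤ if ∀ i ∈ J, ∃ j, g j = f i then (p : ℝ) ^ (2 * e - numEdges H J) else 0 := by
      intro J _
      split_ifs
      · positivity
      · exact le_rfl
    rcases J₀.eq_empty_or_nonempty with hemp | hne
    · rw [hemp, numEdges_empty, Nat.sub_zero] at h1
      exact h1.trans (le_add_of_nonneg_right (Finset.sum_nonneg hnn))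
    · refine h1.trans (le_trans ?_ (le_add_of_nonneg_left (by positivity)))
      refine le_trans (le_of_eq ?_) (Finset.single_le_sum hnn
        (Finset.mem_filter.2 ⟨Finset.mem_univ J₀, hne⟩))
      rw [if_pos fun i hi => (Finset.mem_filter.1 hi).2]
  have hsum := Finset.sum_le_sum fun f (_ : f ∈ (Finset.univ : Finset (Fin n ↪ Fin N))) =>
    Finset.sum_le_sum fun g (_ : g ∈ (Finset.univ : Finset (Fin n ↪ Fin N))) => hterm f g
  have hsq : ∑ _f : Fin n ↪ Fin N, ∑ _g : Fin n ↪ Fin N, (p : ℝ) ^ (2 * e) =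
      (Fintype.card (Fin n ↪ Fin N) * (p : ℝ) ^ e) ^ 2 := by
    simp only [Finset.sum_const, Finset.card_univ, nsmul_eq_mul]
    ring
  simp only [Finset.sum_add_distrib] at hsum
  rw [hsq] at hsum
  refine (sub_le_iff_le_add'.2 hsum).trans ?_
  rw [Finset.sum_comm, Finset.sum_congr rfl fun g _ => Finset.sum_comm, Finset.sum_comm]
  refine Finset.sum_le_sum fun J _ => ?_
  have hcard : (Fintype.card (Fin n ↪ Fin N) : ℝ) ≤ (N : ℝ) ^ n := by
    rw [Fintype.card_embedding_eq, Fintype.card_fin, Fintype.card_fin]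
    exact_mod_cast Nat.descFactorial_le_pow N n
  have hinner : ∀ g : Fin n ↪ Fin N, (∑ f : Fin n ↪ Fin N,
      if ∀ i ∈ J, ∃ j, g j = f i then (p : ℝ) ^ (2 * e - numEdges H J) else 0) ≤
      ((n : ℝ) ^ J.card * (N : ℝ) ^ (n - J.card)) * (p : ℝ) ^ (2 * e - numEdges H J) := by
    intro g
    rw [← Finset.sum_filter, Finset.sum_const, nsmul_eq_mul]
    refine mul_le_mul_of_nonneg_right ?_ (by positivity)
    exact_mod_cast card_embedding_le_of_mem_range J g
  refine (Finset.sum_le_card_nsmul _ _ _ fun g _ => hinner g).trans ?_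
  rw [nsmul_eq_mul, Finset.card_univ, mul_assoc ((N : ℝ) ^ n)]
  exact mul_le_mul_of_nonneg_right hcard (by positivity)

/-- If no copy of `H` is induced with closed vertex set, then every copy extends to a copy of a
denser graph. -/
theorem exists_dense_extension {n N s : ℕ} (hs : 1 ≤ s) {H : SimpleGraph (Fin n)}
    {G : SimpleGraph (Fin N)} {f : Fin n ↪ Fin N} (hf : G ∈ copyEvent H f)
    (hbad : ¬ ((∀ i j, G.Adj (f i) (f j) ↔ H.Adj i j) ∧ ClosedUpTo G s (Finset.univ.image f))) :
    ∃ (t : Fin s) (g : Fin t → Fin N) (K : SimpleGraph (Fin n ⊕ Fin t)),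
      numEdges H Finset.univ + t + 1 ≤ numEdges K Finset.univ ∧
        G ∈ copyEvent K (Sum.elim f g) := by
  have hle : H ≤ G.comap f := fun i j hij => hf.2 i j hij
  have hmain : ∃ W : Finset (Fin N), Disjoint (Finset.univ.image f) W ∧ W.card < s ∧
      numEdges H Finset.univ + W.card + 1 ≤ numEdges G (Finset.univ.image f ∪ W) := by
    by_cases hind : ∀ i j, G.Adj (f i) (f j) ↔ H.Adj i j
    · have hcl : ¬ ClosedUpTo G s (Finset.univ.image f) := fun h => hbad ⟨hind, h⟩
      unfold ClosedUpTo at hcl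
      push Not at hcl
      obtain ⟨W, h1, h2, h3⟩ := hcl
      refine ⟨W, h1, h2, ?_⟩
      have h4 := numEdges_le_of_le hle Finset.univ
      rw [← numEdges_image_univ G f.injective] at h4
      omega
    -- A copy that is not induced already has an extra edge, so no new vertex is needed.
    · refine ⟨∅, Finset.disjoint_empty_right _, by rw [Finset.card_empty]; exact hs, ?_⟩
      have hlt : H < G.comap f := by
        refine lt_of_le_of_ne hle fun heq => hind fun i j => ?_
        rw [heq]
        rfl
      rw [Finset.union_empty, numEdges_image_univ G f.injective]
      exact numEdges_univ_lt_of_lt hlt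
  obtain ⟨W, hd, hWs, hW⟩ := hmain
  obtain ⟨g, hinj, hg⟩ := exists_parametrization G f.injective hd
  exact ⟨⟨W.card, hWs⟩, g, G.comap (Sum.elim f g), by rw [hg]; exact hW, hinj, fun i j hij => hij⟩

-- If no good copy exists, every copy of `H` extends to a copy of a denser graph, so copies are at
-- most as many as dense extensions. The second moment bound applies: overlaps give the first sum,
-- expected dense extensions the second.
open Classical in
theorem real_no_closed_copy_le (p : I) (hp : (0 : ℝ) < p) {n N s : ℕ} (hs : 1 ≤ s)
    (hN : 2 * n ≤ N) (hN1 : 1 ≤ N) (H : SimpleGraph (Fin n)) :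
    (SimpleGraph.binomialRandom (Fin N) p).real {G | ¬ ∃ f : Fin n ↪ Fin N,
      (∀ i j, G.Adj (f i) (f j) ↔ H.Adj i j) ∧ ClosedUpTo G s (Finset.univ.image f)} ≤
    (∑ J : Finset (Fin n) with J.Nonempty,
      4 * 4 ^ n * (n : ℝ) ^ J.card * ((N : ℝ) ^ J.card * (p : ℝ) ^ numEdges H J)⁻¹) +
    ∑ t : Fin s, 2 * 2 ^ n * (Fintype.card (SimpleGraph (Fin n ⊕ Fin t)) : ℝ) *
      ((N : ℝ) ^ (t : ℕ) * (p : ℝ) ^ ((t : ℕ) + 1)) := by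
  set e := numEdges H Finset.univ with he
  set μ := SimpleGraph.binomialRandom (Fin N) p
  have hN0 : (0 : ℝ) < N := by exact_mod_cast hN1
  let κ := Σ t : Fin s, SimpleGraph (Fin n ⊕ Fin t) × (Fin n ⊕ Fin t → Fin N)
  let B : κ → Set (SimpleGraph (Fin N)) := fun j =>
    {G | e + j.1 + 1 ≤ numEdges j.2.1 Finset.univ ∧ G ∈ copyEvent j.2.1 j.2.2}
  set a : ℝ := Fintype.card (Fin n ↪ Fin N) * (p : ℝ) ^ e with ha
  have hhalf : ((N : ℝ) / 2) ^ n * (p : ℝ) ^ e ≤ a :=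
    mul_le_mul_of_nonneg_right (half_pow_le_card_embedding hN) (by positivity)
  have hapos : 0 < a := lt_of_lt_of_le (by positivity) hhalf
  have hE : ∑ f : Fin n ↪ Fin N, μ.real (copyEvent H f) = a := by
    rw [Finset.sum_congr rfl fun f _ => real_copyEvent p H f.injective, Finset.sum_const,
      Finset.card_univ, nsmul_eq_mul]
  have hsub : {G : SimpleGraph (Fin N) | ¬ ∃ f : Fin n ↪ Fin N,
      (∀ i j, G.Adj (f i) (f j) ↔ H.Adj i j) ∧ ClosedUpTo G s (Finset.univ.image f)} ⊆
      {G | ∑ f : Fin n ↪ Fin N, (copyEvent H f).indicator (1 : SimpleGraph (Fin N) → ℝ) G ≤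
        ∑ j : κ, (B j).indicator (1 : SimpleGraph (Fin N) → ℝ) G} := by
    intro G hG
    simp only [Set.mem_ofPred_eq, not_exists] at hG ⊢
    simp only [Set.indicator_apply, Pi.one_apply, Finset.sum_boole]
    -- The extension restricts to `f`, so choosing one for each copy is injective. For an `f` giving
    -- no copy an arbitrary index is returned.
    have hext : ∀ f : Fin n ↪ Fin N, ∃ j : κ, G ∈ copyEvent H f →
        G ∈ B j ∧ ∀ i, j.2.2 (Sum.inl i) = f i := by
      intro f
      by_cases hf : G ∈ copyEvent H f
      · obtain ⟨t, g, K, hK, hG'⟩ := exists_dense_extension hs hf (hG f)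
        exact ⟨⟨t, K, Sum.elim f g⟩, fun _ => ⟨⟨hK, hG'⟩, fun i => rfl⟩⟩
      · exact ⟨⟨⟨0, hs⟩, ⊥, fun _ => ⟨0, hN1⟩⟩, fun h => absurd h hf⟩
    choose j hj using hext
    have hcard := Finset.card_le_card_of_injOn
      (s := Finset.univ.filter fun f : Fin n ↪ Fin N => G ∈ copyEvent H f)
      (t := Finset.univ.filter fun j : κ => G ∈ B j) j
      (fun f hf => Finset.mem_filter.2 ⟨Finset.mem_univ _, (hj f (Finset.mem_filter.1 hf).2).1⟩)
      (fun f hf f' hf' hff => by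
        ext i
        rw [← (hj f (Finset.mem_filter.1 hf).2).2 i, ← (hj f' (Finset.mem_filter.1 hf').2).2 i,
          hff])
    refine le_trans ?_ (le_of_eq (Finset.sum_boole _ _).symm)
    exact_mod_cast hcard
  refine (measureReal_mono hsub (measure_ne_top _ _)).trans
    ((real_sum_indicator_le μ Finset.univ (fun f : Fin n ↪ Fin N => copyEvent H f) Finset.univ B
      hapos hE).trans (add_le_add ?_ ?_))
  · refine (mul_le_mul_of_nonneg_left (sum_real_copyEvent_inter_le p H) (by positivity)).trans ?_
    rw [Finset.mul_sum]
    refine Finset.sum_le_sum fun J _ => ?_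
    have hJn : J.card ≤ n := (Finset.card_le_univ J).trans (by simp)
    have hJe : numEdges H J ≤ 2 * e := by
      have := numEdges_mono H (Finset.subset_univ J)
      omega
    have h1 : (N : ℝ) ^ n * ((n : ℝ) ^ J.card * (N : ℝ) ^ (n - J.card)) *
        (p : ℝ) ^ (2 * e - numEdges H J) = (n : ℝ) ^ J.card *
          ((((N : ℝ) / 2) ^ n * (p : ℝ) ^ e) ^ 2 * 4 ^ n) *
          ((N : ℝ) ^ J.card * (p : ℝ) ^ numEdges H J)⁻¹ := by
      rw [eq_mul_inv_iff_mul_eq₀ (by positivity)]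
      have e1 : (N : ℝ) ^ (n - J.card) * (N : ℝ) ^ J.card = (N : ℝ) ^ n := by
        rw [← pow_add, Nat.sub_add_cancel hJn]
      have e2 : (p : ℝ) ^ (2 * e - numEdges H J) * (p : ℝ) ^ numEdges H J = ((p : ℝ) ^ e) ^ 2 := by
        rw [← pow_add, Nat.sub_add_cancel hJe, mul_comm, pow_mul]
      have e3 : (((N : ℝ) / 2) ^ n * (p : ℝ) ^ e) ^ 2 * 4 ^ n =
          ((N : ℝ) ^ n) ^ 2 * ((p : ℝ) ^ e) ^ 2 := by
        have e4 : (4 : ℝ) ^ n = (2 ^ n) ^ 2 := by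
          rw [← pow_mul, mul_comm, pow_mul]
          norm_num
        rw [e4, div_pow]
        field_simp
      rw [e3, ← e1, ← e2]
      ring
    have h2 : (((N : ℝ) / 2) ^ n * (p : ℝ) ^ e) ^ 2 ≤ a ^ 2 :=
      pow_le_pow_left₀ (by positivity) hhalf 2
    rw [h1]
    calc 4 / a ^ 2 * ((n : ℝ) ^ J.card * ((((N : ℝ) / 2) ^ n * (p : ℝ) ^ e) ^ 2 * 4 ^ n) *
          ((N : ℝ) ^ J.card * (p : ℝ) ^ numEdges H J)⁻¹)
        ≤ 4 / a ^ 2 * ((n : ℝ) ^ J.card * (a ^ 2 * 4 ^ n) *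
          ((N : ℝ) ^ J.card * (p : ℝ) ^ numEdges H J)⁻¹) := by gcongr
      _ = _ := by field_simp
  · rw [Fintype.sum_sigma, Finset.mul_sum]
    refine Finset.sum_le_sum fun t _ => ?_
    have hB : ∀ x : SimpleGraph (Fin n ⊕ Fin t) × (Fin n ⊕ Fin t → Fin N),
        μ.real (B ⟨t, x⟩) ≤ (p : ℝ) ^ (e + t + 1) := by
      intro x
      by_cases hx : e + t + 1 ≤ numEdges x.1 Finset.univ
      · refine (measureReal_mono (fun G hG => hG.2) (measure_ne_top _ _)).trans
          ((real_copyEvent_le p x.1 x.2).trans ?_)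
        exact pow_le_pow_of_le_one p.2.1 p.2.2 hx
      · have : B ⟨t, x⟩ = ∅ := by
          ext G
          simp only [B, Set.mem_ofPred_eq, hx, false_and, Set.mem_empty_iff_false]
        rw [this, measureReal_empty]
        positivity
    have h1 := Finset.sum_le_card_nsmul Finset.univ _ _ fun x _ => hB x
    rw [nsmul_eq_mul, Finset.card_univ, Fintype.card_prod, Fintype.card_fun, Fintype.card_sum,
      Fintype.card_fin, Fintype.card_fin, Fintype.card_fin, Nat.cast_mul, Nat.cast_pow] at h1
    refine (mul_le_mul_of_nonneg_left h1 (by positivity)).trans ?_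
    set c : ℝ := (Fintype.card (SimpleGraph (Fin n ⊕ Fin t)) : ℝ)
    have h2 : c * (N : ℝ) ^ (n + (t : ℕ)) * (p : ℝ) ^ (e + t + 1) =
        (((N : ℝ) / 2) ^ n * (p : ℝ) ^ e) * (2 ^ n * c * ((N : ℝ) ^ (t : ℕ) *
          (p : ℝ) ^ ((t : ℕ) + 1))) := by
      rw [div_pow]
      field_simp
      ring
    rw [h2]
    calc 2 / a * ((((N : ℝ) / 2) ^ n * (p : ℝ) ^ e) * (2 ^ n * c * ((N : ℝ) ^ (t : ℕ) *
          (p : ℝ) ^ ((t : ℕ) + 1))))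
        ≤ 2 / a * (a * (2 ^ n * c * ((N : ℝ) ^ (t : ℕ) * (p : ℝ) ^ ((t : ℕ) + 1)))) := by gcongr
      _ = _ := by field_simp

theorem tendsto_no_closed_copy {α D : ℝ} {s n : ℕ} (hs : 1 ≤ s) (hsD : (s : ℝ) < D)
    (hα : α = 1 - 1 / D) (H : SimpleGraph (Fin n))
    (hH : ∀ J : Finset (Fin n), J.Nonempty → (D - 1) * numEdges H J < D * J.card) :
    Tendsto (fun N : ℕ => (SimpleGraph.binomialRandom (Fin N) (edgeProb α N)).real
      {G | ¬ ∃ f : Fin n ↪ Fin N, (∀ i j, G.Adj (f i) (f j) ↔ H.Adj i j) ∧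
        ClosedUpTo G s (Finset.univ.image f)}) atTop (𝓝 0) := by
  classical
  have hs1 : (1 : ℝ) ≤ s := by exact_mod_cast hs
  have hD0 : 0 < D := by linarith
  have hα0 : 0 ≤ α := by
    rw [hα, sub_nonneg, div_le_one hD0]
    linarith
  have hαD : α = (D - 1) / D := by
    rw [hα]
    field_simp
  refine squeeze_zero' (.of_forall fun N => measureReal_nonneg)
    (((eventually_ge_atTop (2 * n)).and (eventually_ge_atTop 1)).mono fun N hN =>
      real_no_closed_copy_le _ (edgeProb_pos hα0 hN.2) hs hN.1 hN.2 H) ?_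
  rw [← add_zero (0 : ℝ)]
  refine Tendsto.add (tendsto_sum_zero _ fun J hJ => ?_) (tendsto_sum_zero _ fun t _ => ?_)
  · rw [← mul_zero (4 * 4 ^ n * (n : ℝ) ^ J.card)]
    refine (tendsto_inv_pow_mul_edgeProb_pow hα0 ?_).const_mul _
    rw [hαD, div_mul_eq_mul_div, div_lt_iff₀ hD0]
    linarith [hH J (Finset.mem_filter.1 hJ).2]
  · rw [← mul_zero (2 * 2 ^ n * (Fintype.card (SimpleGraph (Fin n ⊕ Fin t)) : ℝ))]
    refine (tendsto_pow_mul_edgeProb_pow hα0 ?_).const_mul _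
    -- The exponent condition `t < α (t + 1)` amounts to `t + 1 < D`.
    have ht : ((t : ℕ) : ℝ) + 1 ≤ s := by exact_mod_cast t.2
    rw [hαD, div_mul_eq_mul_div, lt_div_iff₀ hD0]
    push_cast
    nlinarith

end ClosedCopies

/-! ### The zero-one law. -/

section Law

theorem tendsto_not_isGood {α D : ℝ} {s : ℕ} (hs : 1 ≤ s) (hsD : (s : ℝ) < D)
    (hα : α = 1 - 1 / D) (M m K n₀ : ℕ) :
    Tendsto (fun N : ℕ => (SimpleGraph.binomialRandom (Fin N) (edgeProb α N)).real
      {G | ¬ IsGood G D s M m K n₀}) atTop (𝓝 0) := by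
  classical
  have hs1 : (1 : ℝ) ≤ s := by exact_mod_cast hs
  have hD : 1 < D := by linarith
  have hα0 : 0 ≤ α := by
    rw [hα, sub_nonneg, div_le_one (by linarith)]
    exact hD.le
  have hα1 : α < 1 := by
    rw [hα]
    have : 0 < 1 / D := by positivity
    linarith
  have hcopy := tendsto_sum_zero (Finset.range (n₀ + 1)) fun n _ =>
    tendsto_sum_zero ((Finset.univ : Finset (SimpleGraph (Fin n))).filter fun H =>
      ∀ J : Finset (Fin n), J.Nonempty → (D - 1) * numEdges H J < D * J.card)
      fun H hH => tendsto_no_closed_copy hs hsD hα H (Finset.mem_filter.1 hH).2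
  have htot := ((tendsto_not_sparse hD hα m K).add (tendsto_not_degree hα0 hα1 M)).add hcopy
  rw [add_zero, add_zero] at htot
  refine squeeze_zero (fun N => measureReal_nonneg) (fun N => ?_) htot
  set μ := SimpleGraph.binomialRandom (Fin N) (edgeProb α N)
  let S₁ : Set (SimpleGraph (Fin N)) := {G | ¬ ∃ Y : Finset (Fin N), Y.card = m ∧
    ∀ W : Finset (Fin N), Disjoint Y W → W.card ≤ K →
      (D - 1) * numEdges G (Y ∪ W) ≤ D * W.card}
  let S₂ : Set (SimpleGraph (Fin N)) := {G | ¬ ∀ (v : Fin N) (A : Finset (Fin N)),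
    A.card ≤ M → ∃ u ∉ A, G.Adj v u}
  let S₃ : (n : ℕ) → SimpleGraph (Fin n) → Set (SimpleGraph (Fin N)) := fun n H =>
    {G | ¬ ∃ f : Fin n ↪ Fin N, (∀ i j, G.Adj (f i) (f j) ↔ H.Adj i j) ∧
      ClosedUpTo G s (Finset.univ.image f)}
  have hsub : {G : SimpleGraph (Fin N) | ¬ IsGood G D s M m K n₀} ⊆
      (S₁ ∪ S₂) ∪ ⋃ n ∈ Finset.range (n₀ + 1),
        ⋃ H ∈ (Finset.univ : Finset (SimpleGraph (Fin n))).filter (fun H =>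
          ∀ J : Finset (Fin n), J.Nonempty → (D - 1) * numEdges H J < D * J.card), S₃ n H := by
    intro G hG
    by_contra hcon
    simp only [Set.mem_union, not_or, Set.mem_iUnion, not_exists] at hcon
    refine hG ⟨not_not.1 hcon.1.1, not_not.1 hcon.1.2, fun n hn H hH => ?_⟩
    exact not_not.1 (hcon.2 n (Finset.mem_range.2 (by omega)) H
      (Finset.mem_filter.2 ⟨Finset.mem_univ _, hH⟩))
  refine (measureReal_mono hsub (measure_ne_top _ _)).trans
    ((measureReal_union_le _ _).trans (add_le_add (measureReal_union_le _ _) ?_))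
  refine (measureReal_biUnion_finset_le _ _).trans (Finset.sum_le_sum fun n _ => ?_)
  exact measureReal_biUnion_finset_le _ _

theorem obeys_of_notMem_fractions {k : ℕ} (hk : 1 ≤ k) {α β : ℝ}
    (hβ : β ∈ Set.Ioi (0 : ℝ) \ fractions k) (hα : α = 1 - 1 / ((2 : ℝ) ^ (k - 1) + β)) :
    Obeys k (edgeProb α) := by
  intro φ hφ
  obtain ⟨s, hs⟩ : ∃ s : ℕ, s = 2 ^ (k - 1) := ⟨_, rfl⟩
  have hs1 : 1 ≤ s := hs ▸ Nat.one_le_two_pow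
  have hβ0 : 0 < β := hβ.1
  obtain ⟨D, hD⟩ : ∃ D : ℝ, D = s + β := ⟨_, rfl⟩
  have hDs : D - s = β := by rw [hD]; ring
  have hαD : α = 1 - 1 / D := by
    rw [hα, hD, hs]
    push_cast
    rfl
  obtain ⟨M₀, hM₀⟩ := exists_nat_ge (((s : ℝ) - 1) * (s / (D - s)) + s)
  obtain ⟨m, hm⟩ := exists_nat_gt (D * ((M₀ + s : ℕ) : ℝ) / β)
  have hm' : D * ((M₀ + s : ℕ) : ℝ) < m * (D - s) := by
    rw [hDs]
    exact (div_lt_iff₀ hβ0).1 hm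
  have hlim := tendsto_not_isGood hs1 (by linarith : (s : ℝ) < D) hαD (M₀ + s) m
    (M₀ + s + m * s) ((M₀ + s + 1) * s)
  have hlim' := (ENNReal.tendsto_ofReal hlim).congr fun N => ofReal_measureReal
  rw [ENNReal.ofReal_zero] at hlim'
  -- One good model of `φ`, of any order, forces `φ` in all good graphs; without one, `φ` implies
  -- not being good.
  by_cases hex : ∃ (N : ℕ) (G : SimpleGraph (Fin N)),
      IsGood G D s (M₀ + s) m (M₀ + s + m * s) ((M₀ + s + 1) * s) ∧ Satisfies G φ
  · right
    obtain ⟨N₀, G₀, hG₀, hφ₀⟩ := hex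
    have hcompl : Tendsto (fun N : ℕ => 1 - SimpleGraph.binomialRandom (Fin N) (edgeProb α N)
        {G | ¬ IsGood G D s (M₀ + s) m (M₀ + s + m * s) ((M₀ + s + 1) * s)}) atTop (𝓝 1) := by
      simpa using ENNReal.Tendsto.sub (tendsto_const_nhds (x := (1 : ENNReal))) hlim'
        (Or.inl ENNReal.one_ne_top)
    refine tendsto_of_tendsto_of_tendsto_of_le_of_le hcompl tendsto_const_nhds (fun N => ?_)
      (fun N => prob_le_one)
    rw [tsub_le_iff_right, ← measure_univ
      (μ := SimpleGraph.binomialRandom (Fin N) (edgeProb α N))]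
    refine (measure_mono fun G _ => ?_).trans (measure_union_le _ _)
    by_cases hG : IsGood G D s (M₀ + s) m (M₀ + s + m * s) ((M₀ + s + 1) * s)
    · exact Or.inl ((hG.satisfies_iff hk hG₀ hβ hs hD hM₀ le_rfl hm' le_rfl le_rfl φ hφ).2 hφ₀)
    · exact Or.inr hG
  · left
    refine tendsto_of_tendsto_of_tendsto_of_le_of_le tendsto_const_nhds hlim' (fun N => zero_le)
      (fun N => measure_mono fun G hG hgood => hex ⟨N, G, hgood, hG⟩)

end Law

/-! ### Topology of the set of exponents. -/

section Exponents

/-- Above `β/2` only finitely many fractions occur: the numerators are bounded, hence so are the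
denominators. -/
theorem isOpen_Ioi_diff_fractions (k : ℕ) : IsOpen (Set.Ioi (0 : ℝ) \ fractions k) := by
  rw [isOpen_iff_mem_nhds]
  rintro β ⟨hβ, hβf⟩
  have hβ0 : 0 < β := hβ
  obtain ⟨B, hB⟩ := exists_nat_gt ((2 : ℝ) ^ (k - 1) / (β / 2))
  have hfin : (fractions k ∩ Set.Ioi (β / 2)).Finite := by
    refine (((Finset.range (2 ^ (k - 1) + 1) ×ˢ Finset.range (B + 1)).image
      fun q : ℕ × ℕ => (q.1 : ℝ) / q.2).finite_toSet).subset ?_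
    rintro x ⟨⟨a, b, ha, hak, hb, rfl⟩, hx⟩
    refine Finset.mem_coe.2 (Finset.mem_image.2 ⟨(a, b), ?_, rfl⟩)
    rw [Finset.mem_product, Finset.mem_range, Finset.mem_range]
    refine ⟨by simpa [Nat.lt_succ_iff] using hak, ?_⟩
    have hb' : (0 : ℝ) < b := by exact_mod_cast hb
    have hak' : (a : ℝ) ≤ 2 ^ (k - 1) := by exact_mod_cast hak
    have h1 : β / 2 * b < a := (lt_div_iff₀ hb').1 hx
    have h2 : (b : ℝ) < B := by
      refine lt_of_lt_of_le ?_ hB.le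
      rw [lt_div_iff₀ (by positivity)]
      linarith
    have h3 : b < B := by exact_mod_cast h2
    simpa using h3.trans (Nat.lt_succ_self B)
  have h1 : Set.Ioi (β / 2) ∈ 𝓝 β := Ioi_mem_nhds (by linarith)
  have h2 : (fractions k ∩ Set.Ioi (β / 2))ᶜ ∈ 𝓝 β :=
    hfin.isClosed.isOpen_compl.mem_nhds fun h => hβf h.1
  filter_upwards [h1, h2] with x hx hx'
  exact ⟨(half_pos hβ0).trans hx, fun hf => hx' ⟨hf, hx⟩⟩

theorem exponents_eq (k : ℕ) : exponents k = Set.Iio 1 ∩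
    (fun α : ℝ => 1 / (1 - α) - 2 ^ (k - 1)) ⁻¹' (Set.Ioi (0 : ℝ) \ fractions k) := by
  have hs : (0 : ℝ) < 2 ^ (k - 1) := by positivity
  ext α
  constructor
  · rintro ⟨β, hβ, rfl⟩
    have hβ0 : 0 < β := hβ.1
    have hpos : 0 < 1 / ((2 : ℝ) ^ (k - 1) + β) := by positivity
    refine ⟨by simpa using hpos, ?_⟩
    have : (1 : ℝ) / (1 - (1 - 1 / (2 ^ (k - 1) + β))) - 2 ^ (k - 1) = β := by
      rw [sub_sub_cancel, one_div_one_div]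
      ring
    rw [Set.mem_preimage, this]
    exact hβ
  · rintro ⟨hα, hβ⟩
    refine ⟨_, hβ, ?_⟩
    simp

theorem isOpen_exponents (k : ℕ) : IsOpen (exponents k) := by
  rw [exponents_eq]
  refine ContinuousOn.isOpen_inter_preimage ?_ isOpen_Iio (isOpen_Ioi_diff_fractions k)
  refine ContinuousOn.sub (ContinuousOn.div continuousOn_const (by fun_prop) fun α hα => ?_)
    continuousOn_const
  exact (sub_pos.2 hα).ne'

theorem exponents_subset (k : ℕ) :
    exponents k ⊆ Set.Ioo (1 - 1 / (2 : ℝ) ^ (k - 1)) 1 := by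
  rintro _ ⟨β, hβ, rfl⟩
  have hβ0 : 0 < β := hβ.1
  have hs : (0 : ℝ) < 2 ^ (k - 1) := by positivity
  refine ⟨sub_lt_sub_left (one_div_lt_one_div_of_lt hs (by linarith)) 1, ?_⟩
  have : 0 < 1 / ((2 : ℝ) ^ (k - 1) + β) := by positivity
  linarith

theorem exists_rat_mem_exponents (k : ℕ) : ∃ q : ℚ, (q : ℝ) ∈ exponents k := by
  -- `β = 2^(k-1) + 1` exceeds every excluded fraction.
  refine ⟨1 - 1 / (2 ^ (k - 1) + (2 ^ (k - 1) + 1)), 2 ^ (k - 1) + 1, ⟨?_, ?_⟩, by push_cast; rfl⟩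
  · exact Set.mem_Ioi.2 (by positivity)
  · rintro ⟨a, b, -, ha, hb, h⟩
    have ha' : (a : ℝ) ≤ 2 ^ (k - 1) := by exact_mod_cast ha
    have hb' : (1 : ℝ) ≤ b := by exact_mod_cast hb
    have h1 : (a : ℝ) / b ≤ a := div_le_self (Nat.cast_nonneg a) hb'
    linarith

end Exponents

end ZeroOneLaw

theorem mainTheorem1 (k : ℕ) (hk : 3 < k) :
    (∀ α β : ℝ, β ∈ Set.Ioi (0 : ℝ) \ ZeroOneLaw.fractions k →
      α = 1 - 1 / ((2 : ℝ) ^ (k - 1) + β) →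
      ZeroOneLaw.Obeys k (ZeroOneLaw.edgeProb α)) ∧
    IsOpen (ZeroOneLaw.exponents k) ∧
    ZeroOneLaw.exponents k ⊆ Set.Ioo (1 - 1 / (2 : ℝ) ^ (k - 1)) 1 ∧
    ∃ q : ℚ, (q : ℝ) ∈ ZeroOneLaw.exponents k :=
  ⟨fun _ _ hβ hα => ZeroOneLaw.obeys_of_notMem_fractions (by omega) hβ hα,
    ZeroOneLaw.isOpen_exponents k, ZeroOneLaw.exponents_subset k,
    ZeroOneLaw.exists_rat_mem_exponents k⟩
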